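/- Let $\Omega\subseteq\mathbb R^3$ be an open set (for instance a bounded or unbounded Lipschitz domain), let $\gamma_e,\gamma_m>0$ be constants and let $\theta_e,\theta_m\in L^\infty(\Omega,\mathbb R)$. Let $H(\operatorname{curl},\Omega)$ be the space of all $u\in L^2(\Omega)^3=L^2(\Omega,\mathbb C^3)$ whose distributional curl lies in $L^2(\Omega)^3$, normed by $(\|u\|^2+\|\operatorname{curl}u\|^2)^{1/2}$, and let $H_0(\operatorname{curl},\Omega)$ be the closure of $C_c^\infty(\Omega)^3$ in it. Let $\operatorname{curl}$ and $\operatorname{curl}_0$ be the operators in $L^2(\Omega)^3$ acting as the distributional curl, with domains $H(\operatorname{curl},\Omega)$ and $H_0(\operatorname{curl},\Omega)$ respectively. For $\omega\in\mathbb C\setminus\{-i\gamma_e,-i\gamma_m\}$ let $$\mathcal L(\omega)=\begin{pmatrix}-\omega+\frac{\theta_e^2}{\omega+i\gamma_e} & i\operatorname{curl}\\ -i\operatorname{curl}_0 & -\omega+\frac{\theta_m^2}{\omega+i\gamma_m}\end{pmatrix},\qquad \operatorname{dom}\mathcal L(\omega)=H_0(\operatorname{curl},\Omega)\oplus H(\operatorname{curl},\Omega),$$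 an operator in $L^2(\Omega)^3\oplus L^2(\Omega)^3$. Let $$\Sigma=\{\omega\in\mathbb C:\ \operatorname{Re}(\omega)\,\operatorname{Im}(\omega+i\gamma_m/2)\neq0\},$$ let $\Theta_e(\omega)=\omega^2+i\gamma_e\omega-\theta_e^2$ and $\Theta_m(\omega)=\omega^2+i\gamma_m\omega-\theta_m^2$, and for $\omega\in\Sigma$ let $$\mathcal S_1(\omega)=\operatorname{curl}\,\Theta_m(\omega)^{-1}\operatorname{curl}_0-\frac{\Theta_e(\omega)}{(\omega+i\gamma_e)(\omega+i\gamma_m)},$$ $$\operatorname{dom}\mathcal S_1(\omega)=\{u\in H_0(\operatorname{curl},\Omega):\ \Theta_m(\omega)^{-1}\operatorname{curl}_0u\in H(\operatorname{curl},\Omega)\},$$ an operator in $L^2(\Omega)^3$ (functions act as multiplication operators). For a linear operator $T$ in a Hilbert space $H$, let $\sigma(T)$ be the set of $z\in\mathbb C$ for which $T-z$ is not boundedly invertible, i.e. has no everywhere defined bounded two-sided inverse; $\sigma_p(T)$ the set of eigenvalues; $\sigma_c(T)$ the set of $z\in\sigma(T)$ for which $T-z$ is injective with dense range; $\sigma_r(T)$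 the set of $z$ for which $T-z$ is injective and its range is not dense; and $\sigma_e(T)$ the set of $z$ for which there are $u_n\in\operatorname{dom}T$ with $\|u_n\|=1$, $u_n\rightharpoonup0$ weakly and $\|(T-z)u_n\|\to0$. For a pencil $T(\cdot)$ let $\sigma(T)=\{\omega:\ 0\in\sigma(T(\omega))\}$, where $\omega$ ranges over the set on which the pencil is defined, and define $\sigma_x(T)$, $x\in\{p,c,r,e\}$, in the same way. Then $$\sigma(\mathcal L)\cap\Sigma=\sigma(\mathcal S_1)\cap\Sigma\qquad\text{and}\qquad \sigma_x(\mathcal L)\cap\Sigma=\sigma_x(\mathcal S_1)\cap\Sigma\quad\text{for every }x\in\{p,c,r,e\}.$$ -/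

import Mathlib

open MeasureTheory Filter TopologicalSpace
open scoped Topology ENNReal Distributions InnerProductSpace

noncomputable section

namespace DrudeLorentz

/-! ### Spectra of unbounded operators in a Hilbert space -/

section Spectra

variable {H : Type*} [NormedAddCommGroup H] [InnerProductSpace ℂ H]

/-- `T - z` is boundedly invertible: there is a bounded, everywhere defined, two-sided inverse. -/
def IsBoundedlyInvertible (T : H →ₗ.[ℂ] H) (z : ℂ) : Prop :=
  ∃ R : H →L[ℂ] H,
    (∀ f : H, ∃ u : T.domain, (u : H) = R f ∧ T u - z • (u : H) = f) ∧
    ∀ u : T.domain, R (T u - z • (u : H)) = u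

/-- The spectrum `σ(T)`. -/
def spec (T : H →ₗ.[ℂ] H) : Set ℂ := {z | ¬ IsBoundedlyInvertible T z}

/-- `T - z` is injective. -/
def ShiftInjective (T : H →ₗ.[ℂ] H) (z : ℂ) : Prop :=
  ∀ u : T.domain, T u - z • (u : H) = 0 → (u : H) = 0

/-- `T - z` has dense range. -/
def ShiftDenseRange (T : H →ₗ.[ℂ] H) (z : ℂ) : Prop :=
  DenseRange fun u : T.domain => T u - z • (u : H)

/-- The point spectrum (set of eigenvalues) `σ_p(T)`. -/
def pointSpec (T : H →ₗ.[ℂ] H) : Set ℂ :=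
  {z | ∃ u : T.domain, (u : H) ≠ 0 ∧ T u = z • (u : H)}

/-- The continuous spectrum `σ_c(T)`: points of the spectrum at which `T - z` is injective with
dense range. -/
def contSpec (T : H →ₗ.[ℂ] H) : Set ℂ :=
  {z | z ∈ spec T ∧ ShiftInjective T z ∧ ShiftDenseRange T z}

/-- The residual spectrum `σ_r(T)`: points at which `T - z` is injective and its range is not
dense. -/
def resSpec (T : H →ₗ.[ℂ] H) : Set ℂ :=
  {z | ShiftInjective T z ∧ ¬ ShiftDenseRange T z}

/-- The essential spectrum `σ_e(T)`, through singular Weyl sequences: `‖uₙ‖ = 1`, `uₙ ⇀ 0` weakly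
and `(T - z) uₙ → 0` in norm. -/
def essSpec (T : H →ₗ.[ℂ] H) : Set ℂ :=
  {z | ∃ u : ℕ → T.domain, (∀ n, ‖(u n : H)‖ = 1) ∧
    (∀ y : H, Tendsto (fun n => ⟪y, (u n : H)⟫_ℂ) atTop (𝓝 0)) ∧
    Tendsto (fun n => ‖T (u n) - z • (u n : H)‖) atTop (𝓝 0)}

/-- For an operator pencil `ω ↦ T ω`, `ω ∈ D`, and a type `s` of spectrum (spectrum, point
spectrum, ...), the corresponding spectrum `{ω ∈ D | 0 ∈ s (T ω)}` of the pencil. -/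
def pencilSpec (D : Set ℂ) (T : ℂ → H →ₗ.[ℂ] H) (s : (H →ₗ.[ℂ] H) → Set ℂ) : Set ℂ :=
  {ω | ω ∈ D ∧ (0 : ℂ) ∈ s (T ω)}

end Spectra

/-! ### Compositions and block matrices of unbounded operators, on their natural domains -/

section Operators

variable {H : Type*} [AddCommGroup H] [Module ℂ H]

/-- The composition `g f` on its natural domain `{x ∈ dom f | f x ∈ dom g}`. -/
def compNat (g f : H →ₗ.[ℂ] H) : H →ₗ.[ℂ] H where
  domain :=
    { carrier := {x | ∃ hx : x ∈ f.domain, f ⟨x, hx⟩ ∈ g.domain}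
      zero_mem' := ⟨f.domain.zero_mem, by
        have h : f ⟨0, f.domain.zero_mem⟩ = 0 := f.map_zero
        rw [h]; exact g.domain.zero_mem⟩
      add_mem' := by
        rintro x y ⟨hx, hx'⟩ ⟨hy, hy'⟩
        refine ⟨f.domain.add_mem hx hy, ?_⟩
        have h : f ⟨x + y, f.domain.add_mem hx hy⟩ = f ⟨x, hx⟩ + f ⟨y, hy⟩ :=
          f.map_add ⟨x, hx⟩ ⟨y, hy⟩
        rw [h]; exact g.domain.add_mem hx' hy'
      smul_mem' := by
        rintro c x ⟨hx, hx'⟩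
        refine ⟨f.domain.smul_mem c hx, ?_⟩
        have h : f ⟨c • x, f.domain.smul_mem c hx⟩ = c • f ⟨x, hx⟩ := f.map_smul c ⟨x, hx⟩
        rw [h]; exact g.domain.smul_mem c hx' }
  toFun :=
    { toFun := fun x => g ⟨f ⟨x.1, x.2.1⟩, x.2.2⟩
      map_add' := fun x y => by
        rw [← g.map_add]; congr 1; apply Subtype.ext
        exact f.map_add ⟨x.1, x.2.1⟩ ⟨y.1, y.2.1⟩
      map_smul' := fun c x => by
        rw [RingHom.id_apply, ← g.map_smul]; congr 1; apply Subtype.ext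
        exact f.map_smul c ⟨x.1, x.2.1⟩ }

/-- The block operator matrix `(u, v) ↦ (A u + B v, C u + D v)` in the Hilbert space `H ⊕ H`, with
domain `(dom A ∩ dom C) ⊕ (dom B ∩ dom D)`. -/
def blockOp (A B C D : H →ₗ.[ℂ] H) : WithLp 2 (H × H) →ₗ.[ℂ] WithLp 2 (H × H) where
  domain :=
    { carrier := {z | (z.fst ∈ A.domain ∧ z.fst ∈ C.domain) ∧ (z.snd ∈ B.domain ∧ z.snd ∈ D.domain)}
      zero_mem' := ⟨⟨A.domain.zero_mem, C.domain.zero_mem⟩, ⟨B.domain.zero_mem, D.domain.zero_mem⟩⟩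
      add_mem' := fun hx hy =>
        ⟨⟨A.domain.add_mem hx.1.1 hy.1.1, C.domain.add_mem hx.1.2 hy.1.2⟩,
          ⟨B.domain.add_mem hx.2.1 hy.2.1, D.domain.add_mem hx.2.2 hy.2.2⟩⟩
      smul_mem' := fun c _ hx =>
        ⟨⟨A.domain.smul_mem c hx.1.1, C.domain.smul_mem c hx.1.2⟩,
          ⟨B.domain.smul_mem c hx.2.1, D.domain.smul_mem c hx.2.2⟩⟩ }
  toFun :=
    { toFun := fun z => WithLp.toLp 2
        (A ⟨z.1.fst, z.2.1.1⟩ + B ⟨z.1.snd, z.2.2.1⟩, C ⟨z.1.fst, z.2.1.2⟩ + D ⟨z.1.snd, z.2.2.2⟩)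
      map_add' := fun x y => by
        refine WithLp.ofLp_injective 2 (Prod.ext ?_ ?_)
        · exact (congrArg₂ (· + ·) (A.map_add ⟨x.1.fst, x.2.1.1⟩ ⟨y.1.fst, y.2.1.1⟩)
            (B.map_add ⟨x.1.snd, x.2.2.1⟩ ⟨y.1.snd, y.2.2.1⟩)).trans (add_add_add_comm _ _ _ _)
        · exact (congrArg₂ (· + ·) (C.map_add ⟨x.1.fst, x.2.1.2⟩ ⟨y.1.fst, y.2.1.2⟩)
            (D.map_add ⟨x.1.snd, x.2.2.2⟩ ⟨y.1.snd, y.2.2.2⟩)).trans (add_add_add_comm _ _ _ _)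
      map_smul' := fun c x => by
        refine WithLp.ofLp_injective 2 (Prod.ext ?_ ?_)
        · exact (congrArg₂ (· + ·) (A.map_smul c ⟨x.1.fst, x.2.1.1⟩)
            (B.map_smul c ⟨x.1.snd, x.2.2.1⟩)).trans (smul_add _ _ _).symm
        · exact (congrArg₂ (· + ·) (C.map_smul c ⟨x.1.fst, x.2.1.2⟩)
            (D.map_smul c ⟨x.1.snd, x.2.2.2⟩)).trans (smul_add _ _ _).symm }

end Operators

/-! ### Vector fields on an open subset of `ℝ³` and the two realisations of `curl` -/

/-- Euclidean space `ℝ³`. -/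
abbrev R3 := EuclideanSpace ℝ (Fin 3)

/-- The space `ℂ³` of values of the fields. -/
abbrev C3 := EuclideanSpace ℂ (Fin 3)

/-- Lebesgue measure on `Ω`. -/
abbrev vol (Ω : Opens R3) : Measure R3 := (volume : Measure R3).restrict (Ω : Set R3)

/-- The Hilbert space `L²(Ω)³ = L²(Ω, ℂ³)`. -/
abbrev L2 (Ω : Opens R3) := Lp C3 2 (vol Ω)

/-- The classical partial derivative `∂ⱼ φₖ`. -/
def pderiv (φ : R3 → C3) (j k : Fin 3) (x : R3) : ℂ :=
  fderiv ℝ (fun y => φ y k) x (EuclideanSpace.single j (1 : ℝ))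

/-- The classical curl of a smooth field. -/
def curlFun (φ : R3 → C3) (x : R3) : C3 :=
  !₂[pderiv φ 1 2 x - pderiv φ 2 1 x,
     pderiv φ 2 0 x - pderiv φ 0 2 x,
     pderiv φ 0 1 x - pderiv φ 1 0 x]

section TestFields

variable {Ω : Opens R3}

theorem contDiff_coord (φ : 𝓓(Ω, C3)) (k : Fin 3) : ContDiff ℝ (⊤ : ℕ∞) (fun y => φ y k) := by
  have h : ContDiff ℝ (⊤ : ℕ∞) (φ : R3 → C3) := φ.contDiff
  exact ((EuclideanSpace.proj (𝕜 := ℂ) k).restrictScalars ℝ).contDiff.comp h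

theorem hasCompactSupport_coord (φ : 𝓓(Ω, C3)) (k : Fin 3) :
    HasCompactSupport (fun y => φ y k) :=
  φ.hasCompactSupport.comp_left (g := fun z : C3 => z k) rfl

theorem tsupport_coord' (φ : 𝓓(Ω, C3)) (k : Fin 3) :
    tsupport (fun y => φ y k) ⊆ tsupport φ :=
  tsupport_comp_subset (g := fun z : C3 => z k) rfl φ

theorem tsupport_coord (φ : 𝓓(Ω, C3)) (k : Fin 3) : tsupport (fun y => φ y k) ⊆ Ω :=
  (tsupport_coord' φ k).trans φ.tsupport_subset

theorem continuous_pderiv (φ : 𝓓(Ω, C3)) (j k : Fin 3) : Continuous (pderiv φ j k) := by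
  have h := (contDiff_coord φ k).continuous_fderiv (by simp)
  exact h.clm_apply continuous_const

theorem hasCompactSupport_pderiv (φ : 𝓓(Ω, C3)) (j k : Fin 3) :
    HasCompactSupport (pderiv φ j k) :=
  (hasCompactSupport_coord φ k).fderiv_apply ℝ _

theorem memLp_test (φ : 𝓓(Ω, C3)) : MemLp φ 2 (vol Ω) :=
  φ.continuous.memLp_of_hasCompactSupport φ.hasCompactSupport

theorem memLp_curlFun (φ : 𝓓(Ω, C3)) : MemLp (curlFun φ) 2 (vol Ω) := by
  refine Continuous.memLp_of_hasCompactSupport ?_ ?_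
  · have := continuous_pderiv φ
    unfold curlFun
    fun_prop
  · refine HasCompactSupport.of_support_subset_isCompact
      (K := tsupport φ) φ.hasCompactSupport ?_
    intro x hx
    by_contra hxs
    apply hx
    have hz : ∀ j k, pderiv φ j k x = 0 := by
      intro j k
      have hk : x ∉ tsupport (fun y => φ y k) := fun hh =>
        hxs (tsupport_coord' φ k hh)
      unfold pderiv
      rw [fderiv_of_notMem_tsupport (𝕜 := ℝ) hk]
      rfl
    ext i
    fin_cases i <;> simp [curlFun, hz]

theorem pderiv_add (φ ψ : 𝓓(Ω, C3)) (j k : Fin 3) (x : R3) :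
    pderiv (φ + ψ : 𝓓(Ω, C3)) j k x = pderiv φ j k x + pderiv ψ j k x := by
  have hφ := ((contDiff_coord φ k).differentiable (by simp)) x
  have hψ := ((contDiff_coord ψ k).differentiable (by simp)) x
  have h : fderiv ℝ (fun y => (φ + ψ : 𝓓(Ω, C3)) y k) x
      = fderiv ℝ (fun y => φ y k) x + fderiv ℝ (fun y => ψ y k) x := fderiv_add hφ hψ
  unfold pderiv
  rw [h]; rfl

theorem pderiv_smul (c : ℂ) (φ : 𝓓(Ω, C3)) (j k : Fin 3) (x : R3) :
    pderiv (c • φ : 𝓓(Ω, C3)) j k x = c * pderiv φ j k x := by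
  have hφ := ((contDiff_coord φ k).differentiable (by simp)) x
  have h : fderiv ℝ (fun y => (c • φ : 𝓓(Ω, C3)) y k) x
      = c • fderiv ℝ (fun y => φ y k) x := fderiv_const_smul hφ c
  unfold pderiv
  rw [h]; rfl

theorem curlFun_add (φ ψ : 𝓓(Ω, C3)) :
    curlFun (φ + ψ : 𝓓(Ω, C3)) = curlFun φ + curlFun ψ := by
  funext x; ext i
  fin_cases i <;> simp only [curlFun, pderiv_add] <;> simp [curlFun] <;> ring

theorem curlFun_smul (c : ℂ) (φ : 𝓓(Ω, C3)) :
    curlFun (c • φ : 𝓓(Ω, C3)) = c • curlFun φ := by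
  funext x; ext i
  fin_cases i <;> simp only [curlFun, pderiv_smul] <;> simp [curlFun] <;> ring

end TestFields

/-- The graph `{(φ, curl φ) | φ ∈ C_c^∞(Ω)³}` in `L²(Ω)³ × L²(Ω)³`. -/
def testCurlGraph (Ω : Opens R3) : Submodule ℂ (L2 Ω × L2 Ω) where
  carrier := {p | ∃ φ : 𝓓(Ω, C3), 
    p = ((memLp_test φ).toLp φ, (memLp_curlFun φ).toLp (curlFun φ))}
  zero_mem' := by
    refine ⟨0, ?_⟩
    have h : curlFun (0 : 𝓓(Ω, C3)) = 0 := by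
      have := curlFun_smul 0 (0 : 𝓓(Ω, C3))
      simpa using this
    refine Prod.ext ?_ ?_
    · exact ((MemLp.toLp_eq_toLp_iff (memLp_test 0) MemLp.zero).2 (ae_of_all _ fun _ => rfl)).symm
    · exact ((MemLp.toLp_eq_toLp_iff (memLp_curlFun 0) MemLp.zero).2
        (ae_of_all _ fun x => by rw [h])).symm
  add_mem' := by
    rintro _ _ ⟨φ, rfl⟩ ⟨ψ, rfl⟩
    refine ⟨φ + ψ, Prod.ext ?_ ?_⟩
    · exact (MemLp.toLp_eq_toLp_iff ((memLp_test φ).add (memLp_test ψ)) (memLp_test (φ + ψ))).2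
        (ae_of_all _ fun _ => rfl)
    · exact (MemLp.toLp_eq_toLp_iff ((memLp_curlFun φ).add (memLp_curlFun ψ))
        (memLp_curlFun (φ + ψ))).2
        (ae_of_all _ fun x => by rw [curlFun_add])
  smul_mem' := by
    rintro c _ ⟨φ, rfl⟩
    refine ⟨c • φ, Prod.ext ?_ ?_⟩
    · exact (MemLp.toLp_eq_toLp_iff ((memLp_test φ).const_smul c) (memLp_test (c • φ))).2
        (ae_of_all _ fun _ => rfl)
    · exact (MemLp.toLp_eq_toLp_iff ((memLp_curlFun φ).const_smul c)
        (memLp_curlFun (c • φ))).2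
        (ae_of_all _ fun x => by rw [curlFun_smul])

theorem integrable_inner_L2 {Ω : Opens R3} {f : R3 → C3} (hf : MemLp f 2 (vol Ω)) (u : L2 Ω) :
    Integrable (fun x => ⟪f x, u x⟫_ℂ) (vol Ω) := by
  have h := L2.integrable_inner (𝕜 := ℂ) hf.toLp u
  refine h.congr ?_
  filter_upwards [hf.coeFn_toLp] with x hx
  rw [hx]

/-- The graph of the distributional curl in `L²(Ω)³`: all pairs `(u, w)` such that `curl u = w` in
the sense of distributions on `Ω`, i.e.
`∫_Ω ⟨curl φ, u⟩ = ∫_Ω ⟨φ, w⟩` for all test fields `φ ∈ C_c^∞(Ω)³`. -/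
def weakCurlGraph (Ω : Opens R3) : Submodule ℂ (L2 Ω × L2 Ω) where
  carrier := {p | ∀ φ : 𝓓(Ω, C3),
    ∫ x, ⟪curlFun φ x, p.1 x⟫_ℂ ∂(vol Ω) = ∫ x, ⟪φ x, p.2 x⟫_ℂ ∂(vol Ω)}
  zero_mem' := by
    intro φ
    refine (integral_eq_zero_of_ae ?_).trans (integral_eq_zero_of_ae ?_).symm
    · filter_upwards [Lp.coeFn_zero C3 2 (vol Ω)] with x hx
      rw [Prod.fst_zero, hx, Pi.zero_apply, inner_zero_right, Pi.zero_apply]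
    · filter_upwards [Lp.coeFn_zero C3 2 (vol Ω)] with x hx
      rw [Prod.snd_zero, hx, Pi.zero_apply, inner_zero_right, Pi.zero_apply]
  add_mem' := by
    intro p q hp hq φ
    have key : ∀ {f : R3 → C3}, MemLp f 2 (vol Ω) → ∀ u v : L2 Ω,
        ∫ x, ⟪f x, (u + v : L2 Ω) x⟫_ℂ ∂(vol Ω)
          = ∫ x, ⟪f x, u x⟫_ℂ ∂(vol Ω) + ∫ x, ⟪f x, v x⟫_ℂ ∂(vol Ω) := by
      intro f hf u v
      rw [← integral_add (integrable_inner_L2 hf u) (integrable_inner_L2 hf v)]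
      refine integral_congr_ae ?_
      filter_upwards [Lp.coeFn_add u v] with x hx
      rw [hx, Pi.add_apply, inner_add_right]
    rw [Prod.fst_add, Prod.snd_add, key (memLp_curlFun φ), key (memLp_test φ), hp φ, hq φ]
  smul_mem' := by
    intro c p hp φ
    have key : ∀ (f : R3 → C3) (u : L2 Ω),
        ∫ x, ⟪f x, (c • u : L2 Ω) x⟫_ℂ ∂(vol Ω) = c * ∫ x, ⟪f x, u x⟫_ℂ ∂(vol Ω) := by
      intro f u
      rw [← integral_const_mul]
      refine integral_congr_ae ?_
      filter_upwards [Lp.coeFn_smul c u] with x hx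
      rw [hx, Pi.smul_apply, inner_smul_right]
    rw [Prod.smul_fst, Prod.smul_snd, key, key, hp φ]

/-- The maximal realisation `curl`, with domain `H(curl, Ω)`. -/
def curlMax (Ω : Opens R3) : L2 Ω →ₗ.[ℂ] L2 Ω := (weakCurlGraph Ω).toLinearPMap

/-- The minimal realisation `curl₀`: the closure of `curl` on `C_c^∞(Ω)³`. Its domain is
`H₀(curl, Ω)`, the closure of `C_c^∞(Ω)³` for the norm of `H(curl, Ω)`. -/
def curlMin (Ω : Opens R3) : L2 Ω →ₗ.[ℂ] L2 Ω :=
  (testCurlGraph Ω).topologicalClosure.toLinearPMap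

/-! Both relations are graphs of operators, so that `curlMax` and `curlMin` are what they should
be: this is checked here. -/

theorem weakCurlGraph_single {Ω : Opens R3} (p : L2 Ω × L2 Ω) (hp : p ∈ weakCurlGraph Ω)
    (h0 : p.1 = 0) : p.2 = 0 := by
  have hw : ∀ φ : 𝓓(Ω, C3), ∫ x, ⟪φ x, p.2 x⟫_ℂ ∂(vol Ω) = 0 := by
    intro φ
    rw [← hp φ, h0]
    refine integral_eq_zero_of_ae ?_
    filter_upwards [Lp.coeFn_zero C3 2 (vol Ω)] with x hx
    rw [hx, Pi.zero_apply, inner_zero_right, Pi.zero_apply]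
  have hloc : LocallyIntegrable (p.2 : R3 → C3) (vol Ω) :=
    (Lp.memLp p.2).locallyIntegrable (by norm_num)
  have hcoord : ∀ k : Fin 3, ∀ᵐ x ∂(vol Ω), x ∈ (Ω : Set R3) → p.2 x k = 0 := by
    intro k
    have hk : LocallyIntegrable (fun x => p.2 x k) (vol Ω) := by
      have := (EuclideanSpace.proj (𝕜 := ℂ) k).comp_memLp' (Lp.memLp p.2)
      exact this.locallyIntegrable (by norm_num)
    refine Ω.isOpen.ae_eq_zero_of_integral_contDiff_smul_eq_zero (hk.locallyIntegrableOn _) ?_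
    intro g hg hgc hgs
    let φ : 𝓓(Ω, C3) :=
      { toFun := fun x => (g x : ℂ) • EuclideanSpace.single k (1 : ℂ)
        contDiff' := by
          have h1 : ContDiff ℝ (⊤ : ℕ∞) fun x => (g x : ℂ) := Complex.ofRealCLM.contDiff.comp hg
          exact h1.smul contDiff_const
        hasCompactSupport' := hgc.comp_left
          (g := fun t : ℝ => (t : ℂ) • (EuclideanSpace.single k (1 : ℂ) : C3)) (by simp)
        tsupport_subset' := (tsupport_comp_subset
          (g := fun t : ℝ => (t : ℂ) • (EuclideanSpace.single k (1 : ℂ) : C3))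
          (by simp) g).trans hgs }
    rw [← hw φ]
    refine integral_congr_ae (ae_of_all _ fun x => ?_)
    have hφ : φ x = (g x : ℂ) • EuclideanSpace.single k (1 : ℂ) := rfl
    simp only [hφ, inner_smul_left, EuclideanSpace.inner_single_left]
    simp
  refine (Lp.eq_zero_iff_ae_eq_zero).2 ?_
  filter_upwards [hcoord 0, hcoord 1, hcoord 2, ae_restrict_mem Ω.isOpen.measurableSet]
    with x h0 h1 h2 hx
  ext i
  fin_cases i
  · exact h0 hx
  · exact h1 hx
  · exact h2 hx

theorem integrable_pderiv_mul {Ω : Opens R3} (φ ψ : 𝓓(Ω, C3)) (j k l : Fin 3) :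
    Integrable fun x => (starRingEnd ℂ) (pderiv φ j k x) * ψ x l := by
  have h1 := continuous_pderiv φ j k
  have h2 := (contDiff_coord ψ l).continuous
  have h3 : HasCompactSupport fun x => (starRingEnd ℂ) (pderiv φ j k x) * ψ x l :=
    (hasCompactSupport_coord ψ l).mul_left
  exact Continuous.integrable_of_hasCompactSupport
    ((Complex.continuous_conj.comp h1).mul h2) h3

theorem integrable_mul_pderiv {Ω : Opens R3} (φ ψ : 𝓓(Ω, C3)) (j k l : Fin 3) :
    Integrable fun x => (starRingEnd ℂ) (φ x k) * pderiv ψ j l x := by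
  have h1 := continuous_pderiv ψ j l
  have h2 := (contDiff_coord φ k).continuous
  have h3 : HasCompactSupport fun x => (starRingEnd ℂ) (φ x k) * pderiv ψ j l x :=
    (hasCompactSupport_pderiv ψ j l).mul_left
  exact Continuous.integrable_of_hasCompactSupport
    ((Complex.continuous_conj.comp h2).mul h1) h3

theorem integral_pderiv_mul {Ω : Opens R3} (φ ψ : 𝓓(Ω, C3)) (j k l : Fin 3) :
    ∫ x, (starRingEnd ℂ) (pderiv φ j k x) * ψ x l
      = - ∫ x, (starRingEnd ℂ) (φ x k) * pderiv ψ j l x := by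
  have h := integral_bilinear_fderiv_right_eq_neg_left_of_integrable (μ := (volume : Measure R3))
    (f := fun y => φ y k) (g := fun y => ψ y l) (v := EuclideanSpace.single j (1 : ℝ))
    (B := (ContinuousLinearMap.mul ℝ ℂ).comp (Complex.conjCLE : ℂ →L[ℝ] ℂ))
    (integrable_pderiv_mul φ ψ j k l) (integrable_mul_pderiv φ ψ j k l)
    (Continuous.integrable_of_hasCompactSupport
      ((Complex.continuous_conj.comp (contDiff_coord φ k).continuous).mul
        (contDiff_coord ψ l).continuous) (hasCompactSupport_coord ψ l).mul_left)
    (fun x _ => (contDiff_coord φ k).differentiable (by simp) x)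
    (fun x _ => (contDiff_coord ψ l).differentiable (by simp) x)
  have h' : ∫ x, (starRingEnd ℂ) (φ x k) * pderiv ψ j l x
      = - ∫ x, (starRingEnd ℂ) (pderiv φ j k x) * ψ x l := h
  rw [h', neg_neg]

theorem integral_six {a b c d e f : R3 → ℂ} (ha : Integrable a) (hb : Integrable b)
    (hc : Integrable c) (hd : Integrable d) (he : Integrable e) (hf : Integrable f) :
    ∫ x, ((a x - b x) + (c x - d x) + (e x - f x))
      = ((∫ x, a x) - ∫ x, b x) + ((∫ x, c x) - ∫ x, d x) + ((∫ x, e x) - ∫ x, f x) := by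
  have h1 : Integrable fun x => a x - b x := ha.sub hb
  have h2 : Integrable fun x => c x - d x := hc.sub hd
  have h3 : Integrable fun x => e x - f x := he.sub hf
  have h4 : Integrable fun x => (a x - b x) + (c x - d x) := h1.add h2
  rw [integral_add h4 h3, integral_add h1 h2, integral_sub ha hb, integral_sub hc hd,
    integral_sub he hf]

theorem integral_curlFun_inner {Ω : Opens R3} (φ ψ : 𝓓(Ω, C3)) :
    ∫ x, ⟪curlFun φ x, ψ x⟫_ℂ = ∫ x, ⟪φ x, curlFun ψ x⟫_ℂ := by
  have hl : ∀ x, ⟪curlFun φ x, ψ x⟫_ℂ =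
      ((starRingEnd ℂ) (pderiv φ 1 2 x) * ψ x 0 - (starRingEnd ℂ) (pderiv φ 2 1 x) * ψ x 0)
      + ((starRingEnd ℂ) (pderiv φ 2 0 x) * ψ x 1 - (starRingEnd ℂ) (pderiv φ 0 2 x) * ψ x 1)
      + ((starRingEnd ℂ) (pderiv φ 0 1 x) * ψ x 2 - (starRingEnd ℂ) (pderiv φ 1 0 x) * ψ x 2) := by
    intro x
    rw [PiLp.inner_apply, Fin.sum_univ_three]
    simp [curlFun]
    ring
  have hr : ∀ x, ⟪φ x, curlFun ψ x⟫_ℂ =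
      ((starRingEnd ℂ) (φ x 0) * pderiv ψ 1 2 x - (starRingEnd ℂ) (φ x 0) * pderiv ψ 2 1 x)
      + ((starRingEnd ℂ) (φ x 1) * pderiv ψ 2 0 x - (starRingEnd ℂ) (φ x 1) * pderiv ψ 0 2 x)
      + ((starRingEnd ℂ) (φ x 2) * pderiv ψ 0 1 x - (starRingEnd ℂ) (φ x 2) * pderiv ψ 1 0 x) := by
    intro x
    rw [PiLp.inner_apply, Fin.sum_univ_three]
    simp [curlFun]
    ring
  have i1 := integrable_pderiv_mul φ ψ
  have i2 := integrable_mul_pderiv φ ψ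
  simp only [hl, hr]
  rw [integral_six (i1 _ _ _) (i1 _ _ _) (i1 _ _ _) (i1 _ _ _) (i1 _ _ _) (i1 _ _ _),
    integral_six (i2 _ _ _) (i2 _ _ _) (i2 _ _ _) (i2 _ _ _) (i2 _ _ _) (i2 _ _ _)]
  simp only [integral_pderiv_mul φ ψ]
  ring

theorem testCurlGraph_le {Ω : Opens R3} : testCurlGraph Ω ≤ weakCurlGraph Ω := by
  rintro _ ⟨ψ, rfl⟩ φ
  have hφ : ∀ x ∉ (Ω : Set R3), φ x = 0 := fun x hx =>
    image_eq_zero_of_notMem_tsupport fun h => hx (φ.tsupport_subset h)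
  have hψ : ∀ x ∉ (Ω : Set R3), ψ x = 0 := fun x hx =>
    image_eq_zero_of_notMem_tsupport fun h => hx (ψ.tsupport_subset h)
  have h1 : ∫ x, ⟪curlFun φ x, ((memLp_test ψ).toLp ψ : L2 Ω) x⟫_ℂ ∂(vol Ω)
      = ∫ x, ⟪curlFun φ x, ψ x⟫_ℂ ∂(vol Ω) := by
    refine integral_congr_ae ?_
    filter_upwards [(memLp_test ψ).coeFn_toLp] with x hx
    rw [hx]
  have h2 : ∫ x, ⟪φ x, ((memLp_curlFun ψ).toLp (curlFun ψ) : L2 Ω) x⟫_ℂ ∂(vol Ω)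
      = ∫ x, ⟪φ x, curlFun ψ x⟫_ℂ ∂(vol Ω) := by
    refine integral_congr_ae ?_
    filter_upwards [(memLp_curlFun ψ).coeFn_toLp] with x hx
    rw [hx]
  rw [h1, h2, setIntegral_eq_integral_of_forall_compl_eq_zero fun x hx => by
      rw [hψ x hx, inner_zero_right],
    setIntegral_eq_integral_of_forall_compl_eq_zero fun x hx => by
      rw [hφ x hx, inner_zero_left]]
  exact integral_curlFun_inner φ ψ

theorem isClosed_weakCurlGraph {Ω : Opens R3} :
    IsClosed (weakCurlGraph Ω : Set (L2 Ω × L2 Ω)) := by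
  have key : ∀ {f : R3 → C3} (hf : MemLp f 2 (vol Ω)) (u : L2 Ω),
      ∫ x, ⟪f x, u x⟫_ℂ ∂(vol Ω) = ⟪hf.toLp, u⟫_ℂ := by
    intro f hf u
    rw [L2.inner_def]
    refine integral_congr_ae ?_
    filter_upwards [hf.coeFn_toLp] with x hx
    rw [hx]
  have h : (weakCurlGraph Ω : Set (L2 Ω × L2 Ω)) = ⋂ φ : 𝓓(Ω, C3),
      {p | ⟪(memLp_curlFun φ).toLp, p.1⟫_ℂ = ⟪(memLp_test φ).toLp, p.2⟫_ℂ} := by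
    ext p
    simp only [Set.mem_iInter, Set.mem_ofPred_eq, ← key]
    exact Iff.rfl
  rw [h]
  exact isClosed_iInter fun φ => isClosed_eq (by fun_prop) (by fun_prop)

theorem curlMax_graph (Ω : Opens R3) : (curlMax Ω).graph = weakCurlGraph Ω :=
  Submodule.toLinearPMap_graph_eq _ weakCurlGraph_single

theorem curlMin_graph (Ω : Opens R3) :
    (curlMin Ω).graph = (testCurlGraph Ω).topologicalClosure :=
  Submodule.toLinearPMap_graph_eq _ fun p hp => weakCurlGraph_single p
    (Submodule.topologicalClosure_minimal _ testCurlGraph_le isClosed_weakCurlGraph hp)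

/-! ### The Drude-Lorentz pencil and its Schur complement -/

/-- The domain `{u ∈ L²(Ω)³ | m u ∈ L²(Ω)³}` of multiplication by `m : Ω → ℂ`. -/
def mulDomain (Ω : Opens R3) (m : R3 → ℂ) : Submodule ℂ (L2 Ω) where
  carrier := {u | MemLp (fun x => m x • u x) 2 (vol Ω)}
  zero_mem' := by
    refine (memLp_congr_ae ?_).1 (MemLp.zero (p := 2) (μ := vol Ω) (ε := C3))
    filter_upwards [Lp.coeFn_zero C3 2 (vol Ω)] with x hx
    rw [hx, Pi.zero_apply, smul_zero]
  add_mem' := fun {u v} hu hv => by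
    refine (memLp_congr_ae ?_).1 (MemLp.add hu hv)
    filter_upwards [Lp.coeFn_add u v] with x hx
    rw [hx, Pi.add_apply, Pi.add_apply, smul_add]
  smul_mem' := fun c u hu => by
    refine (memLp_congr_ae ?_).1 (MemLp.const_smul hu c)
    filter_upwards [Lp.coeFn_smul c u] with x hx
    rw [hx, Pi.smul_apply, Pi.smul_apply, smul_comm]

theorem memLp_mul {Ω : Opens R3} {m : R3 → ℂ} (u : mulDomain Ω m) :
    MemLp (fun x => m x • (u : L2 Ω) x) 2 (vol Ω) := u.2

/-- The maximal operator of multiplication by a function `m : Ω → ℂ` in `L²(Ω)³`; its domain is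
all of `L²(Ω)³` if `m` is essentially bounded. -/
def mulOp (Ω : Opens R3) (m : R3 → ℂ) : L2 Ω →ₗ.[ℂ] L2 Ω where
  domain := mulDomain Ω m
  toFun :=
    { toFun := fun u => (memLp_mul u).toLp (fun x => m x • (u : L2 Ω) x)
      map_add' := fun u v => by
        rw [← MemLp.toLp_add, MemLp.toLp_eq_toLp_iff]
        filter_upwards [Lp.coeFn_add (u : L2 Ω) (v : L2 Ω)] with x hx
        rw [Submodule.coe_add, hx, Pi.add_apply, Pi.add_apply, smul_add]
      map_smul' := fun c u => by
        rw [RingHom.id_apply, ← MemLp.toLp_const_smul, MemLp.toLp_eq_toLp_iff]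
        filter_upwards [Lp.coeFn_smul c (u : L2 Ω)] with x hx
        rw [Submodule.coe_smul, hx, Pi.smul_apply, Pi.smul_apply, smul_comm] }

/-- The function `Θ(ω) = ω² + iγω - θ²` on `Ω`, for a constant `γ` and a function `θ`. -/
def Theta (γ : ℝ) (θ : R3 → ℝ) (ω : ℂ) (x : R3) : ℂ :=
  ω ^ 2 + Complex.I * γ * ω - (θ x : ℂ) ^ 2

/-- The Drude-Lorentz block pencil
`𝓛(ω) = [[-ω + θₑ²/(ω + iγₑ), i curl], [-i curl₀, -ω + θₘ²/(ω + iγₘ)]]`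
in `L²(Ω)³ ⊕ L²(Ω)³`, with domain `H₀(curl, Ω) ⊕ H(curl, Ω)`. -/
def pencilL (Ω : Opens R3) (γe γm : ℝ) (θe θm : R3 → ℝ) (ω : ℂ) :
    WithLp 2 (L2 Ω × L2 Ω) →ₗ.[ℂ] WithLp 2 (L2 Ω × L2 Ω) :=
  blockOp
    (mulOp Ω fun x => -ω + (θe x : ℂ) ^ 2 / (ω + Complex.I * γe))
    (Complex.I • curlMax Ω)
    (-Complex.I • curlMin Ω)
    (mulOp Ω fun x => -ω + (θm x : ℂ) ^ 2 / (ω + Complex.I * γm))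

/-- The first Schur complement `𝓢₁(ω) = curl Θₘ(ω)⁻¹ curl₀ - Θₑ(ω) / ((ω + iγₑ)(ω + iγₘ))` in
`L²(Ω)³`, with domain `{u ∈ H₀(curl, Ω) | Θₘ(ω)⁻¹ curl₀ u ∈ H(curl, Ω)}`. -/
def pencilS (Ω : Opens R3) (γe γm : ℝ) (θe θm : R3 → ℝ) (ω : ℂ) : L2 Ω →ₗ.[ℂ] L2 Ω :=
  compNat (curlMax Ω) (compNat (mulOp Ω fun x => (Theta γm θm ω x)⁻¹) (curlMin Ω))
    - mulOp Ω fun x => Theta γe θe ω x / ((ω + Complex.I * γe) * (ω + Complex.I * γm))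

/-- The set `Σ = {ω | Re ω · Im (ω + iγₘ/2) ≠ 0}`. -/
def SigmaSet (γm : ℝ) : Set ℂ := {ω | ω.re * (ω + Complex.I * γm / 2).im ≠ 0}

/-- The domain `ℂ ∖ {-iγₑ, -iγₘ}` of the pencil `𝓛`. -/
def domL (γe γm : ℝ) : Set ℂ := {-(Complex.I * γe), -(Complex.I * γm)}ᶜ

end DrudeLorentz

end

open DrudeLorentz

/-!
Fix `ω ∈ Σ`, put `c = ω + iγₘ`, and write `K = curl`, `K₀ = curl₀`. Formally, eliminating `v` from
`𝓛(ω)(u, v) = (f, g)` leads to an equation with `𝓢₁(ω) u`; the difficulty is that `Θₘ(ω)⁻¹ g` need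
not lie in `H(curl, Ω)`, so that a right-hand side with `g ≠ 0` cannot be eliminated directly.

The way around it is that `Im Θₘ(ω) = 2 Re ω · Im (ω + iγₘ/2)` is a nonzero constant `s`. After the
substitution `v = c v'` and division of the first row by `c`, the operator `𝓛(ω)` becomes
`T - i s`, with `T = [[0, i K], [-i K₀, -Re Θₘ(ω)]]`, up to a bounded term in the upper left entry.
Since `K₀` and `K` are adjoint to each other (`mutuallyAdjoint_curl`), `T` is self-adjoint
(`MutuallyAdjoint.blockOp_selfAdjoint`), hence `T - i s` is boundedly invertible
(`exists_resolvent_of_selfAdjoint`). So `𝓛(ω)` is a boundedly invertible operator plus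
`(u, v) ↦ (M u, 0)` with `M` bounded.

With `G` the inverse of the unperturbed operator, subtracting `G (0, g)` from a solution reduces
`𝓛(ω) z = (f, g)` to a right-hand side `(f', 0)`, with `f'` depending continuously on `(f, g)`, and
such an equation is equivalent to `c 𝓢₁(ω) u = f'`. Moreover `z` is then recovered from `u` and
`f'` by bounded operators, `z = G (f' - M u, 0)`. This is `IsSchurComplement`, from which the
equivalence of bounded invertibility, injectivity, density of the range and existence of singular Weyl sequences follows.
-/

open DrudeLorentz

noncomputable section

namespace DrudeLorentz

/-! ### Spectra at zero in terms of the graph -/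

section Graph

variable {H : Type*} [NormedAddCommGroup H] [InnerProductSpace ℂ H]

theorem isBoundedlyInvertible_zero_iff {T : H →ₗ.[ℂ] H} :
    IsBoundedlyInvertible T 0 ↔
      ∃ R : H →L[ℂ] H, ∀ u f, (u, f) ∈ T.graph ↔ u = R f := by
  constructor
  · rintro ⟨R, h1, h2⟩
    refine ⟨R, fun u f => ⟨fun h => ?_, fun h => ?_⟩⟩
    · obtain ⟨x, rfl, rfl⟩ := T.mem_graph_iff.1 h
      simpa using (h2 x).symm
    · obtain ⟨x, hx, hf⟩ := h1 f
      exact T.mem_graph_iff.2 ⟨x, hx.trans h.symm, by simpa using hf⟩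
  · rintro ⟨R, h⟩
    refine ⟨R, fun f => ?_, fun u => ?_⟩
    · obtain ⟨x, hx, hf⟩ := T.mem_graph_iff.1 ((h (R f) f).2 rfl)
      exact ⟨x, hx, by simpa using hf⟩
    · simpa using ((h u (T u)).1 (T.mem_graph u)).symm

theorem shiftInjective_zero_iff {T : H →ₗ.[ℂ] H} :
    ShiftInjective T 0 ↔ ∀ u, (u, (0 : H)) ∈ T.graph → u = 0 := by
  constructor
  · intro h u hu
    obtain ⟨x, rfl, hx⟩ := T.mem_graph_iff.1 hu
    exact h x (by simpa using hx)
  · intro h u hu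
    exact h u (T.mem_graph_iff.2 ⟨u, rfl, by simpa using hu⟩)

theorem zero_mem_pointSpec_iff {T : H →ₗ.[ℂ] H} :
    (0 : ℂ) ∈ pointSpec T ↔ ¬ ShiftInjective T 0 := by
  simp only [pointSpec, ShiftInjective, Set.mem_ofPred_eq, zero_smul, sub_zero, not_forall]
  exact exists_congr fun u => by rw [exists_prop, and_comm]

theorem shiftDenseRange_zero_iff {T : H →ₗ.[ℂ] H} :
    ShiftDenseRange T 0 ↔ Dense {f | ∃ u, (u, f) ∈ T.graph} := by
  have h : (Set.range fun u : T.domain => T u - (0 : ℂ) • (u : H))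
      = {f | ∃ u, (u, f) ∈ T.graph} := by
    ext f
    simp [T.mem_graph_iff]
  rw [ShiftDenseRange, DenseRange, h]

/-- Weak convergence to zero of a sequence in an inner product space. -/
def WeaklyNull (u : ℕ → H) : Prop :=
  ∀ y : H, Tendsto (fun n => ⟪y, u n⟫_ℂ) atTop (𝓝 0)

theorem WeaklyNull.sub {u v : ℕ → H} (hu : WeaklyNull u) (hv : WeaklyNull v) :
    WeaklyNull (u - v) := fun y => by
  simpa [inner_sub_right] using (hu y).sub (hv y)

theorem weaklyNull_of_tendsto {u : ℕ → H} (hu : Tendsto u atTop (𝓝 0)) : WeaklyNull u :=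
  fun y => by simpa using (tendsto_const_nhds (x := y)).inner (𝕜 := ℂ) hu

theorem tendsto_clm_zero {K : Type*} [NormedAddCommGroup K] [InnerProductSpace ℂ K] (A : H →L[ℂ] K)
    {u : ℕ → H} (hu : Tendsto u atTop (𝓝 0)) : Tendsto (fun n => A (u n)) atTop (𝓝 0) := by
  have h := (A.continuous.tendsto 0).comp hu
  rwa [map_zero] at h

theorem WeaklyNull.map {K : Type*} [NormedAddCommGroup K] [InnerProductSpace ℂ K]
    [CompleteSpace H] [CompleteSpace K] {u : ℕ → H} (hu : WeaklyNull u) (A : H →L[ℂ] K) :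
    WeaklyNull fun n => A (u n) := fun y => by
  simpa [ContinuousLinearMap.adjoint_inner_left] using hu (A.adjoint y)

/-- A singular Weyl sequence need not be normalised: it is enough that its norms stay away from
zero. -/
theorem zero_mem_essSpec_iff_exists {T : H →ₗ.[ℂ] H} :
    (0 : ℂ) ∈ essSpec T ↔ ∃ u f : ℕ → H, ∃ δ > 0, (∀ n, (u n, f n) ∈ T.graph) ∧
      (∀ᶠ n in atTop, δ ≤ ‖u n‖) ∧ WeaklyNull u ∧ Tendsto f atTop (𝓝 0) := by
  constructor
  · rintro ⟨u, h1, h2, h3⟩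
    refine ⟨fun n => u n, fun n => T (u n), 1, one_pos, fun n => T.mem_graph _,
      Eventually.of_forall fun n => (h1 n).ge, h2, ?_⟩
    rw [tendsto_zero_iff_norm_tendsto_zero]
    simpa using h3
  · rintro ⟨u, f, δ, hδ, hg, hn, hw, hf⟩
    obtain ⟨N, hN⟩ := eventually_atTop.1 hn
    choose x hx hxf using fun n => T.mem_graph_iff.1 (hg n)
    simp only at hx hxf
    have hpos : ∀ n, 0 < ‖u (n + N)‖ := fun n => hδ.trans_le (hN _ (Nat.le_add_left _ _))
    have hinv : ∀ n, ‖((‖u (n + N)‖⁻¹ : ℝ) : ℂ)‖ ≤ δ⁻¹ := fun n => by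
      rw [Complex.norm_real, norm_inv, norm_norm]
      exact inv_anti₀ hδ (hN _ (Nat.le_add_left _ _))
    have hbd : IsBoundedUnder (· ≤ ·) atTop
        ((‖·‖) ∘ fun n => ((‖u (n + N)‖⁻¹ : ℝ) : ℂ)) :=
      isBoundedUnder_of ⟨δ⁻¹, hinv⟩
    refine ⟨fun n => ((‖u (n + N)‖⁻¹ : ℝ) : ℂ) • x (n + N), fun n => ?_, fun y => ?_, ?_⟩
    · rw [Submodule.coe_smul, hx, norm_smul, Complex.norm_real, norm_inv, norm_norm,
        inv_mul_cancel₀ (hpos n).ne']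
    · have h := hbd.smul_tendsto_zero ((tendsto_add_atTop_iff_nat N).2 (hw y))
      simpa [Submodule.coe_smul, hx, inner_smul_right] using h
    · have h := hbd.smul_tendsto_zero ((tendsto_add_atTop_iff_nat N).2 hf)
      simpa [LinearPMap.map_smul, hxf] using h.norm

end Graph

/-! ### Spectral equivalence of an operator and its Schur complement -/

/-- `S` is, up to the factor `c`, the Schur complement of `L` with respect to the summand `J H` of
`X`, on which `P` is the projection: `S u = f` exactly if `L z = c J f` for some `z` with `P z = u`.
Moreover the perturbation `L - J M P` of `L` is boundedly invertible, with inverse `G`. -/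
structure IsSchurComplement {H X : Type*} [NormedAddCommGroup H] [InnerProductSpace ℂ H]
    [NormedAddCommGroup X] [InnerProductSpace ℂ X] (L : X →ₗ.[ℂ] X) (S : H →ₗ.[ℂ] H)
    (J : H →L[ℂ] X) (P : X →L[ℂ] H) (G : X →L[ℂ] X) (M : H →L[ℂ] H) (c : ℂ) : Prop where
  proj_inj : ∀ u, P (J u) = u
  ne_zero : c ≠ 0
  mem_graph_left : ∀ z w, (z, w) ∈ L.graph ↔ z = G (w - J (M (P z)))
  mem_graph_right : ∀ u f, (u, f) ∈ S.graph ↔ ∃ z, P z = u ∧ (z, c • J f) ∈ L.graph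

namespace IsSchurComplement

variable {H X : Type*} [NormedAddCommGroup H] [InnerProductSpace ℂ H]
  [NormedAddCommGroup X] [InnerProductSpace ℂ X] {L : X →ₗ.[ℂ] X} {S : H →ₗ.[ℂ] H}
  {J : H →L[ℂ] X} {P : X →L[ℂ] H} {G : X →L[ℂ] X} {M : H →L[ℂ] H} {c : ℂ}

/-- The reduced right-hand side `Φ w = reduce J P G M w` of the equation `L z = w`, which is
solvable exactly if `L z' = J (Φ w)` is. -/
def reduce (J : H →L[ℂ] X) (P : X →L[ℂ] H) (G : X →L[ℂ] X) (M : H →L[ℂ] H) : X →L[ℂ] H :=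
  P - M ∘L P ∘L G ∘L (ContinuousLinearMap.id ℂ X - J ∘L P)

theorem reduce_apply (w : X) : reduce J P G M w = P w - M (P (G (w - J (P w)))) := by
  simp [reduce]

theorem reduce_inj (h : IsSchurComplement L S J P G M c) (f : H) : reduce J P G M (J f) = f := by
  simp [reduce_apply, h.proj_inj]

/-- Subtracting from `z` the solution `G (w - J P w)` of the perturbed problem moves the
right-hand side into the summand `J H`. -/
theorem mem_graph_reduce (h : IsSchurComplement L S J P G M c) {z w : X} :
    (z, w) ∈ L.graph ↔ (z - G (w - J (P w)), J (reduce J P G M w)) ∈ L.graph := by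
  rw [h.mem_graph_left, h.mem_graph_left, sub_eq_iff_eq_add, ← map_add]
  have : J (reduce J P G M w) - J (M (P (z - G (w - J (P w))))) + (w - J (P w))
      = w - J (M (P z)) := by
    simp only [reduce_apply, map_sub]
    abel
  rw [this]

/-- A solution `z` of `L z = J f` is recovered from `u = P z` as `G (J f - J (M u))`. -/
theorem mem_graph_right_inv (h : IsSchurComplement L S J P G M c) {u f : H} :
    (u, c⁻¹ • f) ∈ S.graph ↔ (G (J f - J (M u)), J f) ∈ L.graph ∧ P (G (J f - J (M u))) = u := by
  rw [h.mem_graph_right, map_smul, smul_inv_smul₀ h.ne_zero]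
  constructor
  · rintro ⟨z, rfl, hz⟩
    have := (h.mem_graph_left _ _).1 hz
    rw [← this]
    exact ⟨hz, rfl⟩
  · rintro ⟨h1, h2⟩
    exact ⟨_, h2, h1⟩

theorem fst_mem_graph (h : IsSchurComplement L S J P G M c) {z : X} {f : H}
    (hz : (z, J f) ∈ L.graph) : (P z, c⁻¹ • f) ∈ S.graph := by
  rw [h.mem_graph_right, map_smul, smul_inv_smul₀ h.ne_zero]
  exact ⟨z, rfl, hz⟩

theorem isBoundedlyInvertible_iff (h : IsSchurComplement L S J P G M c) :
    IsBoundedlyInvertible L 0 ↔ IsBoundedlyInvertible S 0 := by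
  rw [isBoundedlyInvertible_zero_iff, isBoundedlyInvertible_zero_iff]
  constructor
  · rintro ⟨R, hR⟩
    refine ⟨c • P ∘L R ∘L J, fun u f => ?_⟩
    simp only [h.mem_graph_right, hR, map_smul]
    constructor
    · rintro ⟨z, rfl, rfl⟩
      simp
    · rintro rfl
      exact ⟨_, by simp, rfl⟩
  · rintro ⟨R, hR⟩
    have hJ : ∀ z f, (z, J f) ∈ L.graph ↔ z = G (J (f - M (R (c⁻¹ • f)))) := by
      intro z f
      constructor
      · intro hz
        have h1 := (hR _ _).1 (h.fst_mem_graph hz)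
        rw [← h1, map_sub]
        exact (h.mem_graph_left _ _).1 hz
      · rintro rfl
        have h1 := h.mem_graph_right_inv.1 ((hR (R (c⁻¹ • f)) (c⁻¹ • f)).2 rfl)
        rw [map_sub]
        exact h1.1
    refine ⟨G ∘L (ContinuousLinearMap.id ℂ X - J ∘L P)
      + G ∘L J ∘L (ContinuousLinearMap.id ℂ H - c⁻¹ • M ∘L R) ∘L reduce J P G M, fun z w => ?_⟩
    rw [h.mem_graph_reduce, hJ, sub_eq_iff_eq_add']
    simp

theorem shiftInjective_iff (h : IsSchurComplement L S J P G M c) :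
    ShiftInjective L 0 ↔ ShiftInjective S 0 := by
  rw [shiftInjective_zero_iff, shiftInjective_zero_iff]
  constructor
  · intro hL u hu
    obtain ⟨z, rfl, hz⟩ := (h.mem_graph_right _ _).1 hu
    rw [hL z (by simpa using hz), map_zero]
  · intro hS z hz
    have h0 : P z = 0 := hS _ ((h.mem_graph_right _ _).2 ⟨z, rfl, by simpa using hz⟩)
    simpa [h0] using (h.mem_graph_left _ _).1 hz

theorem shiftDenseRange_iff (h : IsSchurComplement L S J P G M c) :
    ShiftDenseRange L 0 ↔ ShiftDenseRange S 0 := by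
  rw [shiftDenseRange_zero_iff, shiftDenseRange_zero_iff]
  -- The range of `L` is the preimage of the range of `S` under an open surjection.
  set Φ : X →L[ℂ] H := c⁻¹ • reduce J P G M with hΦ
  have hright : ∀ f, Φ (J (c • f)) = f := fun f => by
    simp only [hΦ, _root_.smul_apply, h.reduce_inj, inv_smul_smul₀ h.ne_zero]
  have hsurj : Function.Surjective Φ := fun f => ⟨_, hright f⟩
  have hopen : IsOpenMap Φ := by
    refine IsOpenMap.of_sections fun x => ⟨fun f => x + J (c • (f - Φ x)), ?_, ?_, fun f => ?_⟩
    · fun_prop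
    · simp
    · rw [map_add, hright, add_sub_cancel]
  have hrange : {w | ∃ z, (z, w) ∈ L.graph} = Φ ⁻¹' {f | ∃ u, (u, f) ∈ S.graph} := by
    ext w
    constructor
    · rintro ⟨z, hz⟩
      exact ⟨_, h.fst_mem_graph (h.mem_graph_reduce.1 hz)⟩
    · rintro ⟨u, hu⟩
      have h1 := (h.mem_graph_right_inv.1 hu).1
      refine ⟨G (J (reduce J P G M w) - J (M u)) + G (w - J (P w)), h.mem_graph_reduce.2 ?_⟩
      rwa [add_sub_cancel_right]
  rw [hrange, dense_iff_closure_eq, dense_iff_closure_eq,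
    ← hopen.preimage_closure_eq_closure_preimage Φ.continuous, Set.preimage_eq_univ_iff,
    hsurj.range_eq, Set.univ_subset_iff]

theorem zero_mem_essSpec_iff [CompleteSpace H] [CompleteSpace X]
    (h : IsSchurComplement L S J P G M c) :
    (0 : ℂ) ∈ essSpec L ↔ (0 : ℂ) ∈ essSpec S := by
  rw [zero_mem_essSpec_iff_exists, zero_mem_essSpec_iff_exists]
  constructor
  · rintro ⟨z, w, δ, hδ, hg, hn, hw, h0⟩
    -- Correcting `z n` by a null sequence moves `L (z n)` into `J H`; `P` of the corrected
    -- sequence `z'` stays away from zero because `z' n` is the image under `G` of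
    -- `J (Φ (w n)) - J (M (P (z' n)))`.
    set z' : ℕ → X := fun n => z n - G (w n - J (P (w n))) with hz'
    set g : ℕ → H := fun n => reduce J P G M (w n) with hgdef
    have hg0 : Tendsto g atTop (𝓝 0) := tendsto_clm_zero _ h0
    have hcorr : Tendsto (fun n => G (w n - J (P (w n)))) atTop (𝓝 0) :=
      tendsto_clm_zero (G ∘L (ContinuousLinearMap.id ℂ X - J ∘L P)) h0
    have hL : ∀ n, (z' n, J (g n)) ∈ L.graph := fun n => h.mem_graph_reduce.1 (hg n)
    have hwz' : WeaklyNull z' := hw.sub (weaklyNull_of_tendsto hcorr)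
    have hz'G : ∀ n, z' n = G (J (g n)) - G (J (M (P (z' n)))) := fun n => by
      rw [← map_sub]
      exact (h.mem_graph_left _ _).1 (hL n)
    set C : ℝ := ‖G ∘L J ∘L M‖ + 1 with hC
    have hCpos : 0 < C := by positivity
    have hGJg : Tendsto (fun n => G (J (g n))) atTop (𝓝 0) :=
      tendsto_clm_zero (G ∘L J) hg0
    refine ⟨fun n => P (z' n), fun n => c⁻¹ • g n, δ / 2 / C, by positivity,
      fun n => h.fst_mem_graph (hL n), ?_, hwz'.map P, by simpa using hg0.const_smul c⁻¹⟩
    have e1 := hcorr.norm.eventually_lt_const (u := δ / 4) (by simpa using by positivity)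
    have e2 := hGJg.norm.eventually_lt_const (u := δ / 4) (by simpa using by positivity)
    filter_upwards [hn, e1, e2] with n h1 h2 h3
    rw [div_le_iff₀ hCpos]
    have k1 : ‖z n‖ ≤ ‖z' n‖ + ‖G (w n - J (P (w n)))‖ := by
      simpa [hz'] using norm_add_le (z' n) (G (w n - J (P (w n))))
    have k2 : ‖z' n‖ ≤ ‖G (J (g n))‖ + ‖G (J (M (P (z' n))))‖ := by
      conv_lhs => rw [hz'G n]
      exact norm_sub_le _ _
    have k3 : ‖G (J (M (P (z' n))))‖ ≤ ‖G ∘L J ∘L M‖ * ‖P (z' n)‖ :=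
      (G ∘L J ∘L M).le_opNorm _
    have k4 : ‖P (z' n)‖ * C = ‖G ∘L J ∘L M‖ * ‖P (z' n)‖ + ‖P (z' n)‖ := by
      rw [hC]; ring
    linarith [norm_nonneg (P (z' n))]
  · rintro ⟨u, f, δ, hδ, hg, hn, hw, h0⟩
    choose z hzu hz using fun n => (h.mem_graph_right _ _).1 (hg n)
    have hf : Tendsto (fun n => c • J (f n)) atTop (𝓝 0) :=
      tendsto_clm_zero (c • J) h0
    have hzG : z = (fun n => G (c • J (f n))) - fun n => (G ∘L J ∘L M) (u n) := by
      funext n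
      have := (h.mem_graph_left _ _).1 (hz n)
      rw [hzu, map_sub] at this
      exact this
    refine ⟨z, fun n => c • J (f n), δ / (‖P‖ + 1), by positivity, hz, ?_, ?_, hf⟩
    · filter_upwards [hn] with n h1
      rw [div_le_iff₀ (by positivity)]
      have := P.le_opNorm (z n)
      rw [hzu] at this
      linarith [norm_nonneg (z n)]
    · rw [hzG]
      exact (weaklyNull_of_tendsto (tendsto_clm_zero G hf)).sub (hw.map _)

end IsSchurComplement

/-! ### Resolvent of a self-adjoint operator -/

/-- A self-adjoint operator `T`, given by the property that `(y, w)` lies in its graph exactly if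
`⟪T z, y⟫ = ⟪z, w⟫` on `dom T`, has every nonzero `i s` in its resolvent set. -/
theorem exists_resolvent_of_selfAdjoint {X : Type*} [NormedAddCommGroup X]
    [InnerProductSpace ℂ X] [CompleteSpace X] {T : X →ₗ.[ℂ] X}
    (hT : ∀ y w, (y, w) ∈ T.graph ↔ ∀ p ∈ T.graph, ⟪p.2, y⟫_ℂ = ⟪p.1, w⟫_ℂ)
    {s : ℝ} (hs : s ≠ 0) :
    ∃ R : X →L[ℂ] X, ∀ z f, (z, f + (s * Complex.I) • z) ∈ T.graph ↔ z = R f := by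
  have hclosed : IsClosed (T.graph : Set (X × X)) := by
    have : (T.graph : Set (X × X)) = ⋂ p ∈ T.graph, {q | ⟪p.2, q.1⟫_ℂ = ⟪p.1, q.2⟫_ℂ} := by
      ext q
      simpa using hT q.1 q.2
    rw [this]
    exact isClosed_biInter fun p _ => isClosed_eq (by fun_prop) (by fun_prop)
  have : CompleteSpace T.graph := hclosed.completeSpace_coe
  let A : T.graph →L[ℂ] X :=
    (ContinuousLinearMap.snd ℂ X X - (s * Complex.I) • ContinuousLinearMap.fst ℂ X X) ∘L
      T.graph.subtypeL
  have hA : ∀ p : T.graph, A p = p.1.2 - (s * Complex.I) • p.1.1 := fun p => rfl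
  -- Symmetry makes the cross terms of `‖T z - i s z‖²` cancel.
  have hnorm : ∀ p : T.graph, ‖A p‖ ^ 2 = ‖p.1.2‖ ^ 2 + s ^ 2 * ‖p.1.1‖ ^ 2 := by
    intro p
    have hsym := (hT p.1.1 p.1.2).1 p.2 p.1 p.2
    have him : (⟪p.1.2, p.1.1⟫_ℂ).im = 0 := by
      rw [← Complex.conj_eq_iff_im, inner_conj_symm, hsym]
    have hre : RCLike.re ((s * Complex.I) * ⟪p.1.2, p.1.1⟫_ℂ) = 0 := by
      simp [him]
    rw [hA, @norm_sub_sq ℂ, inner_smul_right, norm_smul, hre]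
    simp [mul_pow]
  have hbound : ∀ p : T.graph, ‖p‖ ≤ max 1 |s|⁻¹ * ‖A p‖ := by
    intro p
    have hs' : 0 < |s| := abs_pos.2 hs
    have h1 : ‖p.1.2‖ ≤ ‖A p‖ := by
      refine (sq_le_sq₀ (by positivity) (norm_nonneg _)).1 ?_
      rw [hnorm]
      nlinarith [sq_nonneg (s * ‖p.1.1‖)]
    have h2 : |s| * ‖p.1.1‖ ≤ ‖A p‖ := by
      refine (sq_le_sq₀ (by positivity) (norm_nonneg _)).1 ?_
      rw [hnorm, mul_pow, sq_abs]
      nlinarith [sq_nonneg ‖p.1.2‖]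
    have h3 : ‖p.1.1‖ ≤ |s|⁻¹ * ‖A p‖ := by
      rw [inv_mul_eq_div, le_div_iff₀ hs', mul_comm]
      exact h2
    refine max_le (h3.trans ?_) (h1.trans ?_)
    · exact mul_le_mul_of_nonneg_right (le_max_right _ _) (norm_nonneg _)
    · exact le_mul_of_one_le_left (norm_nonneg _) (le_max_left _ _)
  have hanti : AntilipschitzWith (Real.toNNReal (max 1 |s|⁻¹)) A :=
    A.antilipschitz_of_bound fun p => by
      rw [Real.coe_toNNReal _ (le_max_of_le_left zero_le_one)]
      exact hbound p
  have hker : A.ker = ⊥ := LinearMap.ker_eq_bot.2 hanti.injective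
  have hran : A.range = ⊤ := by
    have hcl : IsClosed (A.range : Set X) := hanti.isClosed_range A.uniformContinuous
    rw [← hcl.submodule_topologicalClosure_eq, Submodule.topologicalClosure_eq_top_iff,
      Submodule.eq_bot_iff]
    intro y hy
    have hy' : ∀ p : T.graph, ⟪A p, y⟫_ℂ = 0 := fun p =>
      (Submodule.mem_orthogonal _ _).1 hy _ ⟨p, rfl⟩
    have hyT : (y, -((s * Complex.I) • y)) ∈ T.graph := by
      refine (hT _ _).2 fun p hp => ?_
      have h := hy' ⟨p, hp⟩
      rw [hA, inner_sub_left, sub_eq_zero] at h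
      rw [h, inner_neg_right, inner_smul_left, inner_smul_right]
      simp
    have h := hy' ⟨_, hyT⟩
    rw [hA, inner_sub_left, inner_neg_left, inner_smul_left, ← neg_add', neg_eq_zero,
      ← two_mul] at h
    simpa [hs] using h
  let e := ContinuousLinearEquiv.ofBijective A hker hran
  refine ⟨ContinuousLinearMap.fst ℂ X X ∘L T.graph.subtypeL ∘L e.symm, fun z f => ?_⟩
  constructor
  · intro hz
    have h : e ⟨_, hz⟩ = f := by
      change A _ = f
      rw [hA, add_sub_cancel_right]
    have h' : e.symm f = ⟨_, hz⟩ := (e.symm_apply_eq).2 h.symm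
    simp [h']
  · rintro rfl
    have h : A (e.symm f) = f := e.apply_symm_apply f
    rw [hA, sub_eq_iff_eq_add] at h
    have h' := (e.symm f).2
    change ((e.symm f).1.1, f + (s * Complex.I) • (e.symm f).1.1) ∈ T.graph
    rwa [← h]

/-- The double adjoint of a closed linear relation `V` is `V`. -/
theorem mem_of_forall_adjoint {H : Type*} [NormedAddCommGroup H] [InnerProductSpace ℂ H]
    [CompleteSpace H] {V : Submodule ℂ (H × H)} (hV : IsClosed (V : Set (H × H))) {p q : H}
    (hpq : ∀ v w : H, (∀ r ∈ V, ⟪r.2, v⟫_ℂ = ⟪r.1, w⟫_ℂ) → ⟪w, p⟫_ℂ = ⟪v, q⟫_ℂ) :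
    (p, q) ∈ V := by
  let E := WithLp.prodContinuousLinearEquiv 2 ℂ H H
  let W : Submodule ℂ (WithLp 2 (H × H)) := V.comap (E : WithLp 2 (H × H) →ₗ[ℂ] H × H)
  have hW : IsClosed (W : Set (WithLp 2 (H × H))) := hV.preimage E.continuous
  have : CompleteSpace W := hW.completeSpace_coe
  have hmem : WithLp.toLp 2 (p, q) ∈ Wᗮᗮ := by
    rw [Submodule.mem_orthogonal]
    intro z hz
    rw [Submodule.mem_orthogonal] at hz
    have h := hpq z.snd (-z.fst) fun r hr => by
      have h := hz (WithLp.toLp 2 r) hr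
      rw [WithLp.prod_inner_apply] at h
      rw [inner_neg_right]
      exact eq_neg_of_add_eq_zero_right h
    rw [inner_neg_left] at h
    rw [WithLp.prod_inner_apply]
    exact neg_eq_iff_add_eq_zero.1 h
  rw [Submodule.orthogonal_orthogonal] at hmem
  exact hmem

/-! ### Block operators with mutually adjoint off-diagonal entries -/

section Block

variable {H : Type*} [NormedAddCommGroup H] [InnerProductSpace ℂ H]

/-- A bounded operator as an everywhere defined partial operator. -/
def everywhere (A : H →L[ℂ] H) : H →ₗ.[ℂ] H := (A : H →ₗ[ℂ] H).toPMap ⊤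

theorem mem_graph_blockOp_iff {A D : H →L[ℂ] H} {K K₀ : H →ₗ.[ℂ] H}
    {z w : WithLp 2 (H × H)} :
    (z, w) ∈ (blockOp (everywhere A) (Complex.I • K) (-Complex.I • K₀) (everywhere D)).graph ↔
      ∃ x y, (z.fst, x) ∈ K₀.graph ∧ (z.snd, y) ∈ K.graph ∧
        w.fst = A z.fst + Complex.I • y ∧ w.snd = -Complex.I • x + D z.snd := by
  rw [LinearPMap.mem_graph_iff]
  constructor
  · rintro ⟨⟨z, ⟨h1, h2⟩, h3, h4⟩, rfl, rfl⟩
    exact ⟨K₀ ⟨z.fst, h2⟩, K ⟨z.snd, h3⟩, K₀.mem_graph ⟨z.fst, h2⟩, K.mem_graph ⟨z.snd, h3⟩,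
      rfl, rfl⟩
  · rintro ⟨x, y, hx, hy, h1, h2⟩
    obtain ⟨p, hp, rfl⟩ := K₀.mem_graph_iff.1 hx
    obtain ⟨q, hq, rfl⟩ := K.mem_graph_iff.1 hy
    have hp' : z.fst ∈ K₀.domain := (show (p : H) = z.fst from hp) ▸ p.2
    have hq' : z.snd ∈ K.domain := (show (q : H) = z.snd from hq) ▸ q.2
    refine ⟨⟨z, ⟨Submodule.mem_top, hp'⟩, hq', Submodule.mem_top⟩, rfl, ?_⟩
    obtain rfl : p = ⟨z.fst, hp'⟩ := Subtype.ext hp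
    obtain rfl : q = ⟨z.snd, hq'⟩ := Subtype.ext hq
    exact WithLp.ofLp_injective 2 (Prod.ext h1.symm h2.symm)

theorem mem_graph_compNat_sub_iff {Q R : H →L[ℂ] H} {K K₀ : H →ₗ.[ℂ] H} {u f : H} :
    (u, f) ∈ (compNat K (compNat (everywhere Q) K₀) - everywhere R).graph ↔
      ∃ x y, (u, x) ∈ K₀.graph ∧ (Q x, y) ∈ K.graph ∧ f = y - R u := by
  rw [LinearPMap.mem_graph_iff]
  constructor
  · rintro ⟨⟨u, ⟨⟨h1, h2⟩, h3⟩, h4⟩, rfl, rfl⟩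
    exact ⟨K₀ ⟨u, h1⟩, K ⟨Q (K₀ ⟨u, h1⟩), h3⟩, K₀.mem_graph ⟨u, h1⟩, K.mem_graph ⟨_, h3⟩, rfl⟩
  · rintro ⟨x, y, hx, hy, rfl⟩
    obtain ⟨p, rfl, rfl⟩ := K₀.mem_graph_iff.1 hx
    obtain ⟨q, hq, rfl⟩ := K.mem_graph_iff.1 hy
    have hq' : Q (K₀ p) ∈ K.domain := (show (q : H) = Q (K₀ p) from hq) ▸ q.2
    refine ⟨⟨p, ⟨⟨p.2, Submodule.mem_top⟩, hq'⟩, Submodule.mem_top⟩, rfl, ?_⟩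
    obtain rfl : q = ⟨Q (K₀ p), hq'⟩ := Subtype.ext hq
    rfl

/-- The operators `K₀` and `K` are adjoint to each other (as linear relations). -/
structure MutuallyAdjoint (K₀ K : H →ₗ.[ℂ] H) : Prop where
  mem_right : ∀ v w, (v, w) ∈ K.graph ↔ ∀ p ∈ K₀.graph, ⟪p.2, v⟫_ℂ = ⟪p.1, w⟫_ℂ
  mem_left : ∀ v w, (v, w) ∈ K₀.graph ↔ ∀ p ∈ K.graph, ⟪p.2, v⟫_ℂ = ⟪p.1, w⟫_ℂ

/-- If `K₀` and `K` are adjoint to each other and `D` is bounded and symmetric, the block operator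
`[[0, i K], [-i K₀, D]]` is self-adjoint. -/
theorem MutuallyAdjoint.blockOp_selfAdjoint {K₀ K : H →ₗ.[ℂ] H} (h : MutuallyAdjoint K₀ K)
    {D : H →L[ℂ] H} (hD : ∀ u v, ⟪D u, v⟫_ℂ = ⟪u, D v⟫_ℂ) (y w : WithLp 2 (H × H)) :
    (y, w) ∈ (blockOp (everywhere 0) (Complex.I • K) (-Complex.I • K₀) (everywhere D)).graph ↔
      ∀ p ∈ (blockOp (everywhere 0) (Complex.I • K) (-Complex.I • K₀) (everywhere D)).graph,
        ⟪p.2, y⟫_ℂ = ⟪p.1, w⟫_ℂ := by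
  constructor
  · rintro hy ⟨p, r⟩ hp
    obtain ⟨a, b, ha, hb, h1, h2⟩ := mem_graph_blockOp_iff.1 hy
    obtain ⟨c, d, hc, hd, h3, h4⟩ := mem_graph_blockOp_iff.1 hp
    have e1 := (h.mem_right _ _).1 hb _ hc
    have e2 := (h.mem_left _ _).1 ha _ hd
    change ⟪r.fst, y.fst⟫_ℂ + ⟪r.snd, y.snd⟫_ℂ = ⟪p.fst, w.fst⟫_ℂ + ⟪p.snd, w.snd⟫_ℂ
    rw [h1, h2, h3, h4]
    simp only [inner_add_left, inner_add_right, inner_smul_left, inner_smul_right, hD,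
      zero_apply, inner_zero_left, inner_zero_right, e1, e2]
    simp
    ring
  · intro hy
    rw [mem_graph_blockOp_iff]
    -- Testing with vectors `(0, v)` and `(u, 0)` shows that both components of `y` lie in the
    -- domains of the adjoints.
    refine ⟨Complex.I • (w.snd - D y.snd), -Complex.I • w.fst, ?_, ?_, ?_, ?_⟩
    · refine (h.mem_left _ _).2 fun p hp => ?_
      have := hy (WithLp.toLp 2 (0, p.1), WithLp.toLp 2 (Complex.I • p.2, D p.1))
        (mem_graph_blockOp_iff.2 ⟨0, p.2, K₀.graph.zero_mem, hp, by simp, by simp⟩)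
      simp only [WithLp.prod_inner_apply, inner_zero_left, zero_add, inner_smul_left, hD,
        WithLp.ofLp_fst, WithLp.ofLp_snd, Complex.conj_I, neg_mul, inner_smul_right,
        inner_sub_right] at this ⊢
      linear_combination Complex.I * this + ⟪p.2, y.fst⟫_ℂ * Complex.I_sq
    · refine (h.mem_right _ _).2 fun p hp => ?_
      have := hy (WithLp.toLp 2 (p.1, 0), WithLp.toLp 2 (0, -Complex.I • p.2))
        (mem_graph_blockOp_iff.2 ⟨p.2, 0, hp, K.graph.zero_mem, by simp, by simp⟩)
      simp only [WithLp.prod_inner_apply, inner_zero_left, zero_add, add_zero, inner_smul_left,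
        WithLp.ofLp_fst, WithLp.ofLp_snd, map_neg, Complex.conj_I, neg_neg, neg_mul,
        inner_smul_right] at this ⊢
      linear_combination -Complex.I * this + ⟪p.2, y.snd⟫_ℂ * Complex.I_sq
    · simp [smul_smul]
    · simp [smul_smul]

/-- `diag(1, b)` on `H ⊕ H`. -/
def scaleSnd (b : ℂ) : WithLp 2 (H × H) →L[ℂ] WithLp 2 (H × H) :=
  ((WithLp.prodContinuousLinearEquiv 2 ℂ H H).symm : H × H →L[ℂ] WithLp 2 (H × H)) ∘L
    (WithLp.fstL 2 ℂ H H).prod (b • WithLp.sndL 2 ℂ H H)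

/-- The embedding of `H` as the first summand of `H ⊕ H`. -/
def inlL (H : Type*) [NormedAddCommGroup H] [InnerProductSpace ℂ H] :
    H →L[ℂ] WithLp 2 (H × H) :=
  ((WithLp.prodContinuousLinearEquiv 2 ℂ H H).symm : H × H →L[ℂ] WithLp 2 (H × H)) ∘L
    ContinuousLinearMap.inl ℂ H H

/-- Let `Θ - i s` be symmetric. After the substitution `v = c v'`, and division of the first row by
`c`, the block operator with entries `A`, `i K`, `-i K₀`, `-c⁻¹ Θ` becomes `T - i s` for a
self-adjoint `T`, up to a bounded perturbation of its upper left entry. If moreover `Θ` is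
invertible, elimination of `v` turns it into `c (K Θ⁻¹ K₀ + c⁻¹ A)`. -/
theorem MutuallyAdjoint.exists_isSchurComplement [CompleteSpace H] {K₀ K : H →ₗ.[ℂ] H}
    (h : MutuallyAdjoint K₀ K) {A D Θ Q R : H →L[ℂ] H} {s : ℝ} {c : ℂ} (hs : s ≠ 0) (hc : c ≠ 0)
    (hΘ : ∀ u v, ⟪Θ u - (s * Complex.I) • u, v⟫_ℂ = ⟪u, Θ v - (s * Complex.I) • v⟫_ℂ)
    (hQΘ : ∀ u, Q (Θ u) = u) (hΘQ : ∀ u, Θ (Q u) = u)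
    (hD : ∀ u, D u = -(c⁻¹ • Θ u)) (hA : ∀ u, A u = -(c • R u)) :
    ∃ G M, IsSchurComplement
      (blockOp (everywhere A) (Complex.I • K) (-Complex.I • K₀) (everywhere D))
      (compNat K (compNat (everywhere Q) K₀) - everywhere R)
      (inlL H) (WithLp.fstL 2 ℂ H H) G M c := by
  -- The symmetric part of `Θ`.
  let Θr : H →L[ℂ] H := Θ - (s * Complex.I) • ContinuousLinearMap.id ℂ H
  obtain ⟨G, hG⟩ := exists_resolvent_of_selfAdjoint
    (h.blockOp_selfAdjoint (D := -Θr) fun u v => by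
      rw [neg_apply, neg_apply, inner_neg_left, inner_neg_right]
      exact congrArg Neg.neg (hΘ u v)) hs
  refine ⟨scaleSnd c ∘L G ∘L (c⁻¹ • scaleSnd c),
    A + (s * Complex.I * c) • ContinuousLinearMap.id ℂ H,
    fun u => rfl, hc, fun z w => ?_, fun u f => ?_⟩
  · have hinv : ∀ x y : WithLp 2 (H × H), x = scaleSnd c y ↔ scaleSnd c⁻¹ x = y := by
      intro x y
      constructor
      · rintro rfl
        exact WithLp.ofLp_injective 2 (Prod.ext rfl (inv_smul_smul₀ hc _))
      · rintro rfl
        exact WithLp.ofLp_injective 2 (Prod.ext rfl (smul_inv_smul₀ hc _).symm)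
    rw [ContinuousLinearMap.comp_apply, hinv, ContinuousLinearMap.comp_apply, ← hG,
      mem_graph_blockOp_iff, mem_graph_blockOp_iff]
    -- The two rows of `L z = w` are those of `T z' = f + i s z'` after the rescaling.
    have e1 : ∀ y : H, w.fst = A z.fst + Complex.I • y ↔
        c⁻¹ • (w.fst - (A z.fst + (s * Complex.I * c) • z.fst)) + (s * Complex.I) • z.fst
          = (0 : H) + Complex.I • c⁻¹ • y := by
      intro y
      have h1 : c⁻¹ • (s * Complex.I * c) • z.fst = (s * Complex.I) • z.fst := by
        rw [smul_smul]
        congr 1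
        field_simp
      rw [zero_add, smul_comm Complex.I, smul_sub, smul_add, h1, sub_add_eq_sub_sub,
        sub_add_cancel, ← smul_sub, smul_right_inj (inv_ne_zero hc), sub_eq_iff_eq_add']
    have e2 : ∀ x : H, w.snd = -Complex.I • x + D z.snd ↔
        c⁻¹ • c • (w.snd - 0) + (s * Complex.I) • c⁻¹ • z.snd
          = -Complex.I • x + -(Θ (c⁻¹ • z.snd) - (s * Complex.I) • c⁻¹ • z.snd) := by
      intro x
      rw [sub_zero, inv_smul_smul₀ hc, hD, map_smul, neg_sub, add_sub, sub_eq_add_neg,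
        add_right_comm, add_left_inj]
    constructor
    · rintro ⟨x, y, hx, hy, h1, h2⟩
      exact ⟨x, c⁻¹ • y, hx, K.graph.smul_mem _ hy, (e1 y).1 h1, (e2 x).1 h2⟩
    · rintro ⟨x, y, hx, hy, h1, h2⟩
      have hy' : (z.snd, c • y) ∈ K.graph := by
        have h3 := K.graph.smul_mem c hy
        have h4 : c • (c⁻¹ • z.snd) = z.snd := smul_inv_smul₀ hc _
        rwa [← h4]
      refine ⟨x, c • y, hx, hy', (e1 _).2 ?_, (e2 x).2 h2⟩
      rw [inv_smul_smul₀ hc]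
      exact h1
  · rw [mem_graph_compNat_sub_iff]
    constructor
    · rintro ⟨x, y, hx, hy, rfl⟩
      -- The second row `-i K₀ u - c⁻¹ Θ v = 0` forces `v = -i c Θ⁻¹ K₀ u`.
      refine ⟨WithLp.toLp 2 (u, (-(c * Complex.I)) • Q x), rfl, mem_graph_blockOp_iff.2
        ⟨x, (-(c * Complex.I)) • y, hx, K.graph.smul_mem _ hy, ?_, ?_⟩⟩
      · change c • (y - R u) = A u + Complex.I • (-(c * Complex.I)) • y
        rw [hA, smul_smul, smul_sub, sub_eq_neg_add]
        congr 2
        linear_combination c * Complex.I_sq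
      · change c • (0 : H) = -Complex.I • x + D ((-(c * Complex.I)) • Q x)
        rw [hD, map_smul, hΘQ, smul_zero, smul_smul, ← sub_eq_add_neg, ← sub_smul]
        field_simp
        simp
    · rintro ⟨z, rfl, hz⟩
      obtain ⟨x, y, hx, hy, h1, h2⟩ := mem_graph_blockOp_iff.1 hz
      change c • f = A z.fst + Complex.I • y at h1
      change c • (0 : H) = -Complex.I • x + D z.snd at h2
      have hv : Q x = (c⁻¹ * Complex.I) • z.snd := by
        have h3 := congrArg (fun t => Complex.I • Q t) h2
        simp only [hD, map_add, map_neg, map_smul, hQΘ, smul_add, smul_smul, smul_neg,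
          smul_zero, map_zero] at h3
        have h4 : Complex.I * -Complex.I = 1 := by simp
        rw [h4, one_smul, ← sub_eq_add_neg, eq_comm, sub_eq_zero] at h3
        rw [h3, mul_comm]
      refine ⟨x, (c⁻¹ * Complex.I) • y, hx, ?_, ?_⟩
      · rw [hv]
        exact K.graph.smul_mem _ hy
      · have h3 := congrArg (c⁻¹ • ·) h1
        simp only [hA, inv_smul_smul₀ hc, smul_add, smul_neg] at h3
        rw [h3, smul_smul, neg_add_eq_sub]
        rfl

end Block

/-! ### The two realisations of `curl` and multiplication operators -/

theorem integral_inner_eq {Ω : Opens R3} {f : R3 → C3} (hf : MemLp f 2 (vol Ω)) (u : L2 Ω) :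
    ∫ x, ⟪f x, u x⟫_ℂ ∂(vol Ω) = ⟪hf.toLp, u⟫_ℂ := by
  rw [L2.inner_def]
  refine integral_congr_ae ?_
  filter_upwards [hf.coeFn_toLp] with x hx
  rw [hx]

theorem mutuallyAdjoint_curl (Ω : Opens R3) : MutuallyAdjoint (curlMin Ω) (curlMax Ω) := by
  have hr : ∀ v w, (v, w) ∈ (curlMax Ω).graph ↔
      ∀ p ∈ (curlMin Ω).graph, ⟪p.2, v⟫_ℂ = ⟪p.1, w⟫_ℂ := by
    intro v w
    rw [curlMax_graph, curlMin_graph]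
    constructor
    · intro hvw
      let V : Set (L2 Ω × L2 Ω) := {p | ⟪p.2, v⟫_ℂ = ⟪p.1, w⟫_ℂ}
      have hV : IsClosed V := isClosed_eq (by fun_prop) (by fun_prop)
      refine fun p hp => closure_minimal (t := V) ?_ hV hp
      rintro _ ⟨φ, rfl⟩
      have := hvw φ
      rwa [integral_inner_eq (memLp_curlFun φ), integral_inner_eq (memLp_test φ)] at this
    · intro hp φ
      rw [integral_inner_eq (memLp_curlFun φ), integral_inner_eq (memLp_test φ)]
      exact hp _ (Submodule.le_topologicalClosure _ ⟨φ, rfl⟩)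
  refine ⟨hr, fun v w => ⟨fun hvw p hp => ?_, fun hvw => ?_⟩⟩
  · have := (hr p.1 p.2).1 hp _ hvw
    rw [← inner_conj_symm, ← this, inner_conj_symm]
  · rw [curlMin_graph]
    refine mem_of_forall_adjoint (Submodule.isClosed_topologicalClosure _) fun a b hab => ?_
    refine hvw (a, b) ((hr a b).2 ?_)
    rwa [curlMin_graph]

/-- Multiplication by an essentially bounded function, as a bounded operator. -/
def mulCLM {Ω : Opens R3} {m : R3 → ℂ} (hm : MemLp m ⊤ (vol Ω)) : L2 Ω →L[ℂ] L2 Ω :=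
  (ContinuousLinearMap.lsmul ℂ ℂ).holderL (vol Ω) ⊤ 2 2 (hm.toLp m)

theorem coeFn_mulCLM {Ω : Opens R3} {m : R3 → ℂ} (hm : MemLp m ⊤ (vol Ω)) (u : L2 Ω) :
    mulCLM hm u =ᵐ[vol Ω] fun x => m x • u x := by
  have h := (ContinuousLinearMap.lsmul ℂ ℂ : ℂ →L[ℂ] C3 →L[ℂ] C3).coeFn_holder (r := 2)
    (hm.toLp m) u
  filter_upwards [h, hm.coeFn_toLp] with x h1 h2
  refine h1.trans ?_
  rw [h2]
  rfl

theorem mulOp_eq_everywhere {Ω : Opens R3} {m : R3 → ℂ} (hm : MemLp m ⊤ (vol Ω)) :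
    mulOp Ω m = everywhere (mulCLM hm) := by
  have hdom : (mulOp Ω m).domain = ⊤ := by
    refine eq_top_iff.2 fun u _ => ?_
    exact (memLp_congr_ae (coeFn_mulCLM hm u)).1 (Lp.memLp _)
  refine LinearPMap.ext hdom fun u hu hu' => ?_
  refine Lp.ext ?_
  exact (MemLp.coeFn_toLp (memLp_mul ⟨u, hu⟩)).trans (coeFn_mulCLM hm u).symm

theorem mulCLM_comp_of_mul_eq_one {Ω : Opens R3} {m n : R3 → ℂ} (hm : MemLp m ⊤ (vol Ω))
    (hn : MemLp n ⊤ (vol Ω)) (hmn : ∀ x, m x * n x = 1) (u : L2 Ω) :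
    mulCLM hm (mulCLM hn u) = u := by
  refine Lp.ext ?_
  filter_upwards [coeFn_mulCLM hm (mulCLM hn u), coeFn_mulCLM hn u] with x h1 h2
  rw [h1, h2, smul_smul, hmn, one_smul]

theorem mulCLM_eq_smul {Ω : Opens R3} {m n : R3 → ℂ} (hm : MemLp m ⊤ (vol Ω))
    (hn : MemLp n ⊤ (vol Ω)) (b : ℂ) (hmn : ∀ x, m x = b * n x) (u : L2 Ω) :
    mulCLM hm u = b • mulCLM hn u := by
  refine Lp.ext ?_
  filter_upwards [coeFn_mulCLM hm u, coeFn_mulCLM hn u, Lp.coeFn_smul b (mulCLM hn u)]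
    with x h1 h2 h3
  rw [h1, h3, Pi.smul_apply, h2, smul_smul, hmn]

/-- Multiplication by a function whose imaginary part is the constant `s` is symmetric up to
`i s`. -/
theorem mulCLM_sub_symmetric {Ω : Opens R3} {m : R3 → ℂ} (hm : MemLp m ⊤ (vol Ω)) {s : ℝ}
    (hs : ∀ x, (m x).im = s) (u v : L2 Ω) :
    ⟪mulCLM hm u - (s * Complex.I) • u, v⟫_ℂ = ⟪u, mulCLM hm v - (s * Complex.I) • v⟫_ℂ := by
  have h : ∀ w : L2 Ω, (mulCLM hm w - (s * Complex.I) • w : L2 Ω) =ᵐ[vol Ω]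
      fun x => (((m x).re : ℝ) : ℂ) • w x := by
    intro w
    filter_upwards [coeFn_mulCLM hm w, Lp.coeFn_sub (mulCLM hm w) ((s * Complex.I) • w),
      Lp.coeFn_smul (s * Complex.I) w] with x h1 h2 h3
    rw [h2, Pi.sub_apply, h1, h3, Pi.smul_apply, ← sub_smul, ← hs x, sub_eq_iff_eq_add.2]
    exact (Complex.re_add_im _).symm
  rw [L2.inner_def, L2.inner_def]
  refine integral_congr_ae ?_
  filter_upwards [h u, h v] with x h1 h2
  rw [h1, h2, inner_smul_left, inner_smul_right, Complex.conj_ofReal]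

/-! ### The Drude-Lorentz pencil -/

theorem im_Theta (γ : ℝ) (θ : R3 → ℝ) (ω : ℂ) (x : R3) :
    (Theta γ θ ω x).im = 2 * (ω.re * (ω + Complex.I * γ / 2).im) := by
  simp [Theta, pow_two]
  ring

theorem memLp_Theta {Ω : Opens R3} {γ : ℝ} {θ : R3 → ℝ} (hθ : MemLp θ ⊤ (vol Ω)) (ω : ℂ) :
    MemLp (Theta γ θ ω) ⊤ (vol Ω) := by
  have h1 : MemLp (fun x => (θ x : ℂ)) ⊤ (vol Ω) := hθ.ofReal
  have h2 : MemLp (fun x => (θ x : ℂ) * (θ x : ℂ)) ⊤ (vol Ω) := h1.mul h1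
  have h3 := (memLp_top_const (μ := vol Ω) (ω ^ 2 + Complex.I * γ * ω)).sub h2
  refine (memLp_congr_ae (ae_of_all _ fun x => ?_)).1 h3
  simp [Theta, pow_two]

/-- `Θₘ(ω)⁻¹` is bounded because `Im Θₘ(ω)` is a nonzero constant. -/
theorem memLp_Theta_inv {Ω : Opens R3} {γ : ℝ} {θ : R3 → ℝ} (hθ : MemLp θ ⊤ (vol Ω)) {ω : ℂ}
    (hω : ω ∈ SigmaSet γ) : MemLp (fun x => (Theta γ θ ω x)⁻¹) ⊤ (vol Ω) := by
  refine memLp_top_of_bound (memLp_Theta hθ ω).1.inv₀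
    |2 * (ω.re * (ω + Complex.I * γ / 2).im)|⁻¹ (ae_of_all _ fun x => ?_)
  rw [norm_inv, ← im_Theta γ θ ω x]
  refine inv_anti₀ (abs_pos.2 ?_) (Complex.abs_im_le_norm _)
  rw [im_Theta]
  exact mul_ne_zero two_ne_zero hω

theorem add_I_mul_ne_zero {γm : ℝ} {ω : ℂ} (hω : ω ∈ SigmaSet γm) (γ : ℝ) :
    ω + Complex.I * γ ≠ 0 := by
  intro h
  have h1 := congrArg Complex.re h
  have h2 : ω.re = 0 := by simpa using h1
  exact hω (by rw [h2, zero_mul])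

theorem sigmaSet_subset_domL (γe γm : ℝ) : SigmaSet γm ⊆ domL γe γm := by
  intro ω hω
  simp only [domL, Set.mem_compl_iff, Set.mem_insert_iff, Set.mem_singleton_iff, not_or,
    ← add_eq_zero_iff_eq_neg]
  exact ⟨add_I_mul_ne_zero hω γe, add_I_mul_ne_zero hω γm⟩

theorem neg_add_div_eq (γ : ℝ) (θ : R3 → ℝ) {ω : ℂ} (hω : ω + Complex.I * γ ≠ 0) (x : R3) :
    -ω + (θ x : ℂ) ^ 2 / (ω + Complex.I * γ) = -(ω + Complex.I * γ)⁻¹ * Theta γ θ ω x := by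
  rw [Theta]
  field_simp
  ring

/-- On `Σ`, `𝓢₁(ω)` is the Schur complement of `𝓛(ω)` up to the factor `ω + iγₘ`. -/
theorem exists_isSchurComplement_pencil (Ω : Opens R3) (γe γm : ℝ) {θe θm : R3 → ℝ}
    (hθe : MemLp θe ⊤ (vol Ω)) (hθm : MemLp θm ⊤ (vol Ω)) {ω : ℂ} (hω : ω ∈ SigmaSet γm) :
    ∃ G M, IsSchurComplement (pencilL Ω γe γm θe θm ω) (pencilS Ω γe γm θe θm ω)
      (inlL (L2 Ω)) (WithLp.fstL 2 ℂ (L2 Ω) (L2 Ω)) G M (ω + Complex.I * γm) := by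
  have he := add_I_mul_ne_zero hω γe
  have hm := add_I_mul_ne_zero hω γm
  have hTe : MemLp (Theta γe θe ω) ⊤ (vol Ω) := memLp_Theta hθe ω
  have hTm : MemLp (Theta γm θm ω) ⊤ (vol Ω) := memLp_Theta hθm ω
  have hTi := memLp_Theta_inv hθm hω
  have hs : 2 * (ω.re * (ω + Complex.I * γm / 2).im) ≠ 0 := mul_ne_zero two_ne_zero hω
  have hne : ∀ x, Theta γm θm ω x ≠ 0 := fun x h => hs (by
    rw [← im_Theta γm θm ω x, h, Complex.zero_im])
  have hA : MemLp (fun x => -ω + (θe x : ℂ) ^ 2 / (ω + Complex.I * γe)) ⊤ (vol Ω) := by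
    simp only [neg_add_div_eq γe θe he]
    exact hTe.const_mul _
  have hD : MemLp (fun x => -ω + (θm x : ℂ) ^ 2 / (ω + Complex.I * γm)) ⊤ (vol Ω) := by
    simp only [neg_add_div_eq γm θm hm]
    exact hTm.const_mul _
  have hR : MemLp (fun x => Theta γe θe ω x / ((ω + Complex.I * γe) * (ω + Complex.I * γm))) ⊤
      (vol Ω) := by
    simp only [div_eq_inv_mul]
    exact hTe.const_mul _
  rw [pencilL, pencilS, mulOp_eq_everywhere hA, mulOp_eq_everywhere hD, mulOp_eq_everywhere hTi,
    mulOp_eq_everywhere hR]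
  refine (mutuallyAdjoint_curl Ω).exists_isSchurComplement (Θ := mulCLM hTm) hs hm
    (mulCLM_sub_symmetric hTm (im_Theta γm θm ω))
    (mulCLM_comp_of_mul_eq_one hTi hTm fun x => inv_mul_cancel₀ (hne x))
    (mulCLM_comp_of_mul_eq_one hTm hTi fun x => mul_inv_cancel₀ (hne x))
    (fun u => ?_) (fun u => ?_)
  · rw [mulCLM_eq_smul hD hTm _ (neg_add_div_eq γm θm hm), neg_smul]
  · rw [← neg_smul]
    refine mulCLM_eq_smul hA hR _ (fun x => ?_) u
    rw [neg_add_div_eq γe θe he]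
    field_simp

/-- If a type of spectrum contains `0` for `𝓛(ω)` exactly if it does for `𝓢₁(ω)`, the two pencils
have the same spectrum of this type in `Σ`. -/
theorem pencilSpec_inter_sigmaSet_eq {H X : Type*} [NormedAddCommGroup H] [InnerProductSpace ℂ H]
    [NormedAddCommGroup X] [InnerProductSpace ℂ X] {γe γm : ℝ} {L : ℂ → X →ₗ.[ℂ] X}
    {S : ℂ → H →ₗ.[ℂ] H} {t : (X →ₗ.[ℂ] X) → Set ℂ} {t' : (H →ₗ.[ℂ] H) → Set ℂ}
    (h : ∀ ω ∈ SigmaSet γm, (0 : ℂ) ∈ t (L ω) ↔ (0 : ℂ) ∈ t' (S ω)) :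
    pencilSpec (domL γe γm) L t ∩ SigmaSet γm
      = pencilSpec (SigmaSet γm) S t' ∩ SigmaSet γm := by
  ext ω
  constructor
  · rintro ⟨⟨_, h0⟩, hω⟩
    exact ⟨⟨hω, (h ω hω).1 h0⟩, hω⟩
  · rintro ⟨⟨_, h0⟩, hω⟩
    exact ⟨⟨sigmaSet_subset_domL γe γm hω, (h ω hω).2 h0⟩, hω⟩

end DrudeLorentz

end

theorem mainTheorem3 (Ω : TopologicalSpace.Opens R3)
    (γe γm : ℝ) (hγe : 0 < γe) (hγm : 0 < γm)
    (θe θm : R3 → ℝ) (hθe : MeasureTheory.MemLp θe ⊤ (vol Ω))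
    (hθm : MeasureTheory.MemLp θm ⊤ (vol Ω)) :
    pencilSpec (domL γe γm) (pencilL Ω γe γm θe θm) spec ∩ SigmaSet γm
        = pencilSpec (SigmaSet γm) (pencilS Ω γe γm θe θm) spec ∩ SigmaSet γm ∧
    pencilSpec (domL γe γm) (pencilL Ω γe γm θe θm) pointSpec ∩ SigmaSet γm
        = pencilSpec (SigmaSet γm) (pencilS Ω γe γm θe θm) pointSpec ∩ SigmaSet γm ∧
    pencilSpec (domL γe γm) (pencilL Ω γe γm θe θm) contSpec ∩ SigmaSet γm
        = pencilSpec (SigmaSet γm) (pencilS Ω γe γm θe θm) contSpec ∩ SigmaSet γm ∧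
    pencilSpec (domL γe γm) (pencilL Ω γe γm θe θm) resSpec ∩ SigmaSet γm
        = pencilSpec (SigmaSet γm) (pencilS Ω γe γm θe θm) resSpec ∩ SigmaSet γm ∧
    pencilSpec (domL γe γm) (pencilL Ω γe γm θe θm) essSpec ∩ SigmaSet γm
        = pencilSpec (SigmaSet γm) (pencilS Ω γe γm θe θm) essSpec ∩ SigmaSet γm := by
  refine ⟨pencilSpec_inter_sigmaSet_eq fun ω hω => ?_, pencilSpec_inter_sigmaSet_eq fun ω hω => ?_,
    pencilSpec_inter_sigmaSet_eq fun ω hω => ?_, pencilSpec_inter_sigmaSet_eq fun ω hω => ?_,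
    pencilSpec_inter_sigmaSet_eq fun ω hω => ?_⟩ <;>
  obtain ⟨G, M, h⟩ := exists_isSchurComplement_pencil Ω γe γm hθe hθm hω
  · exact not_congr h.isBoundedlyInvertible_iff
  · rw [zero_mem_pointSpec_iff, zero_mem_pointSpec_iff, h.shiftInjective_iff]
  · exact and_congr (not_congr h.isBoundedlyInvertible_iff)
      (and_congr h.shiftInjective_iff h.shiftDenseRange_iff)
  · exact and_congr h.shiftInjective_iff (not_congr h.shiftDenseRange_iff)
  · exact h.zero_mem_essSpec_iff
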